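/- Let $d,m\ge 1$ and $L_0,R>0$, set $u=R\,d^{1/4}$, and write $B_2(0,r)$ for the closed Euclidean ball of radius $r$ in $\mathbb R^d$. Let $\mathcal X\subseteq\mathbb R^d$ be closed and convex, let $P$ be a probability distribution on a measurable space $\Xi$, and let $\{F(\cdot;\xi)\}_{\xi\in\Xi}$ be real-valued functions such that, for $P$-almost every $\xi$, $F(\cdot;\xi)$ is convex on a convex domain $\operatorname{dom}F(\cdot;\xi)\supseteq \mathcal X+B_2(0,u)$. Assume that $F(x;\cdot)$ is $P$-integrable for every $x\in \mathcal X+B_2(0,u)$, put $f(x)=\mathbb E_{\xi\sim P}[F(x;\xi)]$, and assume $$\mathbb E_{\xi\sim P}\big[\|\partial F(x;\xi)\|_2^2\big]\le L_0^2\quad\text{for all }x\in \mathcal X+B_2(0,u),\qquad \|\partial F(x;\xi)\|_2:=\sup\{\|g\|_2: g\in\partial F(x;\xi)\}.$$ Let $\varphi:\mathcal X\to\mathbb R$ be closed and convex, and let $\psi:\mathcal X\to\mathbb R$ be nonnegative, differentiable and strongly convex with respect to the Euclidean norm, i.e. $\psi(y)\ge\psi(x)+\langle\nabla\psi(x),y-x\rangle+\frac12\|x-y\|_2^2$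 for all $x,y\in \mathcal X$. Put $\theta_0=1$, $\theta_{t+1}=2/\big(1+\sqrt{1+4/\theta_t^2}\big)$, $u_t=\theta_t u$, $L_t=L_0\sqrt d/u_t$ and $\eta_t=L_0\sqrt{t+1}/(R\sqrt m)$. Let $Z_{i,t}$ be uniform on $B_2(0,1)$ and $\xi_{i,t}\sim P$ ($1\le i\le m$, $t\ge 0$), all mutually independent. Starting from arbitrary deterministic $x_0,z_0\in \mathcal X$, let, for $t=0,1,2,\dots$, $$y_t=(1-\theta_t)x_t+\theta_t z_t,\qquad g_{i,t}\in\partial F(y_t+u_tZ_{i,t};\xi_{i,t})\ \text{ a.s. }(1\le i\le m),\qquad g_t=\frac1m\sum_{i=1}^m g_{i,t},$$ $$z_{t+1}=\operatorname*{argmin}_{x\in \mathcal X}\Big\{\sum_{\tau=0}^t\frac1{\theta_\tau}\langle g_\tau,x\rangle+\sum_{\tau=0}^t\frac1{\theta_\tau}\varphi(x)+L_{t+1}\psi(x)+\frac{\eta_{t+1}}{\theta_{t+1}}\psi(x)\Big\},\qquad x_{t+1}=(1-\theta_t)x_t+\theta_t z_{t+1},$$ where the $g_{i,t}$ are random vectors.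 Then for every $x^*\in \mathcal X$ with $\psi(x^*)\le R^2$ and every integer $T\ge4$, the random variable $f(x_T)+\varphi(x_T)$ is integrable and $$\mathbb E[f(x_T)+\varphi(x_T)]-[f(x^*)+\varphi(x^*)]\le\frac{10L_0Rd^{1/4}}{T}+\frac{5L_0R}{\sqrt{Tm}}.$$ -/

import Mathlib

open MeasureTheory ProbabilityTheory
open scoped RealInnerProductSpace Pointwise ENNReal

noncomputable section

namespace RandSmooth

/-- The subdifferential at `x` of a function `h` with effective domain `D`
(that is, of the function equal to `h` on `D` and to `+∞` off `D`). -/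
def subdifferential {d : ℕ} (D : Set (EuclideanSpace ℝ (Fin d)))
    (h : EuclideanSpace ℝ (Fin d) → ℝ) (x : EuclideanSpace ℝ (Fin d)) :
    Set (EuclideanSpace ℝ (Fin d)) :=
  {g | x ∈ D ∧ ∀ y ∈ D, h x + ⟪g, y - x⟫ ≤ h y}

/-- `‖∂h(x)‖₂ = sup {‖g‖₂ : g ∈ ∂h(x)}`, with values in `[0, ∞]`. -/
def subdifferentialNorm {d : ℕ} (D : Set (EuclideanSpace ℝ (Fin d)))
    (h : EuclideanSpace ℝ (Fin d) → ℝ) (x : EuclideanSpace ℝ (Fin d)) : ℝ≥0∞ :=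
  ⨆ g ∈ subdifferential D h x, ‖g‖ₑ

/-- A proximal function on `X`: nonnegative, differentiable and strongly convex
(with modulus one) with respect to the Euclidean norm over `X`. -/
structure IsProxFunction {d : ℕ} (X : Set (EuclideanSpace ℝ (Fin d)))
    (ψ : EuclideanSpace ℝ (Fin d) → ℝ) : Prop where
  nonneg : ∀ x ∈ X, 0 ≤ ψ x
  strongly_convex : ∃ gradψ : EuclideanSpace ℝ (Fin d) → EuclideanSpace ℝ (Fin d),
    ∀ x ∈ X, HasGradientWithinAt ψ (gradψ x) X x ∧
      ∀ y ∈ X, ψ x + ⟪gradψ x, y - x⟫ + 1 / 2 * ‖x - y‖ ^ 2 ≤ ψ y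

/-- The objective `f(x) = E[F(x; ξ)]`. -/
def objective {d : ℕ} {Ξ : Type*} [MeasurableSpace Ξ] (P : Measure Ξ)
    (F : EuclideanSpace ℝ (Fin d) → Ξ → ℝ) (x : EuclideanSpace ℝ (Fin d)) : ℝ :=
  ∫ s, F x s ∂P

/-- The uniform distribution on the closed Euclidean unit ball of `ℝ^d`. -/
def unifBall (d : ℕ) : Measure (EuclideanSpace ℝ (Fin d)) :=
  ProbabilityTheory.cond volume (Metric.closedBall 0 1)

/-- The step sequence: `θ₀ = 1`, `θ_{t+1} = 2 / (1 + √(1 + 4 / θ_t²))`. -/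
def theta : ℕ → ℝ
  | 0 => 1
  | t + 1 => 2 / (1 + √(1 + 4 / theta t ^ 2))

/-- `(x, y, z)` is a run, on the probability space `(Ω, Pr)`, of randomized smoothing with
accelerated dual averaging, for the domain `X`, the stochastic objective `F(·; ξ)`
with effective domain `D ξ` and `ξ ∼ P`, the regularizer `φ`, the proximal function `ψ`,
the distribution `μ` of the perturbations, `m` oracle queries per iteration, smoothing
parameters `u_t`, smoothness parameters `L_t` and damping parameters `η_t`.
`Z i t` and `ξ i t` are the random perturbations and the samples, and `g i t` are the stochastic
subgradients returned by the oracle (any element of the subdifferential may be returned).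
The starting points are arbitrary deterministic points of `X`. -/
structure IsRun {d m : ℕ} {Ξ Ω : Type*} [MeasurableSpace Ξ] [MeasurableSpace Ω]
    (X : Set (EuclideanSpace ℝ (Fin d))) (P : Measure Ξ)
    (F : EuclideanSpace ℝ (Fin d) → Ξ → ℝ) (D : Ξ → Set (EuclideanSpace ℝ (Fin d)))
    (φ ψ : EuclideanSpace ℝ (Fin d) → ℝ) (μ : Measure (EuclideanSpace ℝ (Fin d)))
    (u L η : ℕ → ℝ) (Pr : Measure Ω)
    (Z : Fin m → ℕ → Ω → EuclideanSpace ℝ (Fin d)) (ξ : Fin m → ℕ → Ω → Ξ)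
    (g : Fin m → ℕ → Ω → EuclideanSpace ℝ (Fin d))
    (x y z : ℕ → Ω → EuclideanSpace ℝ (Fin d)) : Prop where
  measurable_Z : ∀ i t, Measurable (Z i t)
  measurable_ξ : ∀ i t, Measurable (ξ i t)
  measurable_g : ∀ i t, Measurable (g i t)
  /-- each pair `(Z_{i,t}, ξ_{i,t})` consists of independent variables with laws `μ` and `P` -/
  law : ∀ i t, Measure.map (fun ω => (Z i t ω, ξ i t ω)) Pr = μ.prod P
  /-- the pairs `(Z_{i,t}, ξ_{i,t})`, over all `i` and `t`, are mutually independent -/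
  indep : iIndepFun (fun (p : Fin m × ℕ) ω => (Z p.1 p.2 ω, ξ p.1 p.2 ω)) Pr
  x_init : ∃ x₀ ∈ X, ∀ ω, x 0 ω = x₀
  z_init : ∃ z₀ ∈ X, ∀ ω, z 0 ω = z₀
  y_update : ∀ t ω, y t ω = (1 - theta t) • x t ω + theta t • z t ω
  oracle : ∀ i t, ∀ᵐ ω ∂Pr,
    g i t ω ∈ subdifferential (D (ξ i t ω)) (fun v => F v (ξ i t ω)) (y t ω + u t • Z i t ω)
  z_update : ∀ t, ∀ᵐ ω ∂Pr, z (t + 1) ω ∈ X ∧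
    IsMinOn (fun v =>
      ∑ τ ∈ Finset.range (t + 1),
        1 / theta τ * ⟪(1 / (m : ℝ)) • ∑ i : Fin m, g i τ ω, v⟫
      + ∑ τ ∈ Finset.range (t + 1), 1 / theta τ * φ v
      + L (t + 1) * ψ v + η (t + 1) / theta (t + 1) * ψ v) X (z (t + 1) ω)
  x_update : ∀ t ω, x (t + 1) ω = (1 - theta t) • x t ω + theta t • z (t + 1) ω

end RandSmooth

end

/-!
The smoothed functions `f_t(y) = E[f(y + u_t Z)]` satisfy `f ≤ f_{t+1} ≤ f_t ≤ f + L₀ u_t`, and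
`G_t(y) = E[∇F(y + u_t Z; ξ)]` is a subgradient of `f_t` that is Lipschitz with constant
`L₀ √d / u_t`. The run is therefore accelerated dual averaging for a decreasing sequence of smooth
functions, with stochastic gradients that are unbiased and have variance at most `L₀² / m`.

*Smoothness.* Since `f` is `L₀`-Lipschitz near `X`, the difference of `G_t` at two points is at most
`L₀` times the normalized volume of the symmetric difference of two balls
(`volume_real_closedBall_diff`). Slicing along the shift and log-convexity of `Γ` give the factor
`√d`. The descent inequality follows by subdividing a segment
(`HasBoundedSubgradients.smoothed_descent`), so `f_t` is never differentiated.

*Oracle.* A convex function is differentiable almost everywhere, hence for almost every perturbation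
the subgradient is unique and the answer of the oracle is a jointly measurable function `Γ` of the
query point, the perturbation and the sample (`exists_gradient_field`). The minimizer of each step
is a Lipschitz function of the accumulated subgradients, so the iterates at time `t` are functions
of the randomness before `t` (`IsOracleRun.adapted`); independence then makes the noise `e_t`
orthogonal to `z_t - x*` and divides its variance by the batch size (`IsOracleRun.noise`).

*Potential.* Along a sample path, `θ_t⁻² (f_t + φ)(x_{t+1})` minus the optimal value of the step
objective grows by at most `θ_t⁻¹ (f_t(x*) - ⟪g_t, x*⟫ + ⟪e_t, z_t - x*⟫ + ‖e_t‖² / (2 η_t))` from the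
second step on (`path_bound`). Because `z_0` is arbitrary, the first step is not covered by strong
convexity of `ψ`; its contribution is bounded by a multiple of `L₀ R` using only that `f_0` is
Lipschitz and `ψ ≥ 0` is strongly convex (`first_step_le`), and after division by `θ_{T-1}⁻²` it is
absorbed by the constant `10` (`rate_bound`). Integrability of `φ(x_T)` comes from the sample path
bound above and the linear minorant `exists_linear_lower_bound` below.
-/

namespace RandSmooth

/-! ### The step sequence -/

lemma theta_pos (t : ℕ) : 0 < theta t := by
  cases t with
  | zero => simp [theta]
  | succ t => rw [theta]; positivity

/-- In terms of `a = 1 / θ` the recursion reads `a_{t+1}² - a_{t+1} = a_t²`. -/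
lemma inv_theta_succ_sq (t : ℕ) :
    (1 / theta (t + 1)) ^ 2 - 1 / theta (t + 1) = (1 / theta t) ^ 2 := by
  have h := theta_pos t
  have hs : √(1 + 4 / theta t ^ 2) ^ 2 = 1 + 4 / theta t ^ 2 := Real.sq_sqrt (by positivity)
  have : 1 / theta (t + 1) = (1 + √(1 + 4 / theta t ^ 2)) / 2 := by
    rw [theta, one_div_div]
  rw [this, one_div, inv_pow]
  rw [div_eq_mul_inv 4] at hs
  rw [div_eq_mul_inv 4]
  linear_combination hs / 4

lemma one_div_theta_pos (t : ℕ) : 0 < 1 / theta t := one_div_pos.2 (theta_pos t)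

lemma inv_theta_succ_ge (t : ℕ) : 1 / theta t + 1 / 2 ≤ 1 / theta (t + 1) := by
  have h1 := one_div_theta_pos t
  have h2 := one_div_theta_pos (t + 1)
  have h := inv_theta_succ_sq t
  have h3 : 1 < 1 / theta (t + 1) := by
    by_contra hc
    nlinarith [mul_nonneg h2.le (sub_nonneg.2 (not_lt.1 hc)), pow_pos h1 2]
  have := abs_le_of_sq_le_sq (a := 1 / theta t) (b := 1 / theta (t + 1) - 1 / 2)
    (by nlinarith) (by linarith)
  linarith [le_abs_self (1 / theta t)]

lemma inv_theta_succ_le (t : ℕ) : 1 / theta (t + 1) ≤ 1 / theta t + 1 := by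
  have h1 := one_div_theta_pos t
  have h2 := one_div_theta_pos (t + 1)
  have h := inv_theta_succ_sq t
  nlinarith

lemma le_inv_theta (t : ℕ) : ((t : ℝ) + 2) / 2 ≤ 1 / theta t := by
  induction t with
  | zero => simp [theta]
  | succ t ih => have := inv_theta_succ_ge t; push_cast; linarith

lemma inv_theta_le (t : ℕ) : 1 / theta t ≤ (t : ℝ) + 1 := by
  induction t with
  | zero => simp [theta]
  | succ t ih => have := inv_theta_succ_le t; push_cast; linarith

lemma sum_inv_theta (t : ℕ) :
    ∑ τ ∈ Finset.range (t + 1), 1 / theta τ = (1 / theta t) ^ 2 := by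
  induction t with
  | zero => simp [theta]
  | succ t ih => rw [Finset.sum_range_succ, ih]; linarith [inv_theta_succ_sq t]

lemma theta_le_one (t : ℕ) : theta t ≤ 1 := by
  have h1 := le_inv_theta t
  have h2 := theta_pos t
  rw [le_div_iff₀ h2] at h1
  have : (0 : ℝ) ≤ t := t.cast_nonneg
  nlinarith

lemma theta_succ_le (t : ℕ) : theta (t + 1) ≤ theta t := by
  have h := inv_theta_succ_ge t
  exact (one_div_le_one_div (theta_pos t) (theta_pos (t + 1))).1 (by linarith)

/-! ### The volume gained by shifting a ball -/

lemma measurableSet_shift_slices (n : ℕ) (r s : ℝ) :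
    MeasurableSet {q : ℝ × (Fin n → ℝ) | (q.1 - s) ^ 2 + ∑ i, q.2 i ^ 2 ≤ r ^ 2 ∧
      r ^ 2 < q.1 ^ 2 + ∑ i, q.2 i ^ 2} := by
  rw [Set.ofPred_and]
  exact (measurableSet_le (by fun_prop) (by fun_prop)).inter
    (measurableSet_lt (by fun_prop) (by fun_prop))

/-- Slicing along the first coordinate: each line parallel to the shift meets the difference of the
shifted and the original ball in an interval no longer than the shift. -/
lemma volume_shift_slices (n : ℕ) {r s : ℝ} (hs : 0 ≤ s) :
    volume {q : ℝ × (Fin n → ℝ) | (q.1 - s) ^ 2 + ∑ i, q.2 i ^ 2 ≤ r ^ 2 ∧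
        r ^ 2 < q.1 ^ 2 + ∑ i, q.2 i ^ 2}
      ≤ ENNReal.ofReal s * volume {p : Fin n → ℝ | ∑ i, p i ^ 2 ≤ r ^ 2} := by
  have hm := measurableSet_shift_slices n r s
  have hm' : MeasurableSet {p : Fin n → ℝ | ∑ i, p i ^ 2 ≤ r ^ 2} :=
    measurableSet_le (by fun_prop) (by fun_prop)
  rw [Measure.volume_eq_prod, Measure.prod_apply_symm hm, ← lintegral_indicator_const hm']
  refine lintegral_mono fun p => ?_
  by_cases hp : ∑ i, p i ^ 2 ≤ r ^ 2
  · rw [Set.indicator_of_mem (by exact hp)]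
    set c := √(r ^ 2 - ∑ i, p i ^ 2) with hc
    have hc2 : c ^ 2 = r ^ 2 - ∑ i, p i ^ 2 := Real.sq_sqrt (by linarith)
    have hc0 : 0 ≤ c := Real.sqrt_nonneg _
    calc volume _ ≤ volume (Set.Ioc c (c + s)) := by
          refine measure_mono ?_
          rintro x ⟨h1, h2⟩
          simp only at h1 h2
          have h3 : |x - s| ≤ c := abs_le_of_sq_le_sq (by linarith) hc0
          have h4 := abs_le.1 h3
          refine ⟨?_, by linarith⟩
          by_contra h5
          have := sq_le_sq' (a := x) (b := c) (by linarith) (by linarith)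
          linarith
      _ = ENNReal.ofReal s := by rw [Real.volume_Ioc]; congr 1; ring
  · rw [Set.indicator_of_notMem (by exact hp)]
    refine (measure_mono_null ?_ (measure_empty (μ := (volume : Measure ℝ)))).le
    rintro x ⟨h1, h2⟩
    simp only at h1 h2
    exact hp (by nlinarith [sq_nonneg (x - s)])

lemma volume_shift_single (n : ℕ) {r s : ℝ} (hr : 0 ≤ r) (hs : 0 ≤ s) :
    volume (Metric.closedBall (EuclideanSpace.single (0 : Fin (n + 1)) s) r \
        Metric.closedBall 0 r)
      ≤ ENNReal.ofReal s * volume {p : Fin n → ℝ | ∑ i, p i ^ 2 ≤ r ^ 2} := by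
  refine le_trans (le_of_eq ?_) (volume_shift_slices n hs)
  have h1 := (volume_preserving_piFinSuccAbove (fun _ : Fin (n + 1) => ℝ) 0).comp
    (PiLp.volume_preserving_ofLp (Fin (n + 1)))
  have hm := measurableSet_shift_slices n r s
  rw [← h1.measure_preimage hm.nullMeasurableSet]
  congr 1
  ext x
  have e1 : ∀ y : EuclideanSpace ℝ (Fin (n + 1)), ‖y‖ ≤ r ↔
      y 0 ^ 2 + ∑ i : Fin n, y i.succ ^ 2 ≤ r ^ 2 := fun y => by
    rw [EuclideanSpace.norm_eq, Real.sqrt_le_left hr]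
    simp [Fin.sum_univ_succ]
  simp only [Set.mem_sdiff, Metric.mem_closedBall, dist_eq_norm, Set.mem_preimage, sub_zero, e1,
    not_le, Set.mem_ofPred_eq]
  simp [MeasurableEquiv.piFinSuccAbove, Fin.tail, Fin.succ_ne_zero]

/-- The constant comes from log-convexity of `Γ`, which gives
`Γ(n/2 + 3/2)² ≤ Γ(n/2 + 1)² (n/2 + 1)`. -/
lemma volume_ball_ratio (n : ℕ) {r : ℝ} (hr : 0 < r) :
    volume {p : Fin n → ℝ | ∑ i, p i ^ 2 ≤ r ^ 2}
      ≤ ENNReal.ofReal (√((n + 1 : ℕ) : ℝ) / (2 * r)) *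
        volume (Metric.closedBall (0 : EuclideanSpace ℝ (Fin (n + 1))) r) := by
  rcases Nat.eq_zero_or_pos n with rfl | hn
  · rw [EuclideanSpace.volume_closedBall]
    have h0 : {p : Fin 0 → ℝ | ∑ i, p i ^ 2 ≤ r ^ 2} = Set.univ := by
      ext p; simp [sq_nonneg]
    have hG : Real.Gamma ((1 : ℝ) / 2 + 1) = √Real.pi / 2 := by
      rw [Real.Gamma_add_one (by norm_num), Real.Gamma_one_half_eq]; ring
    have hpi : √Real.pi ≠ 0 := by positivity
    rw [h0, Measure.volume_pi_eq_dirac (0 : Fin 0 → ℝ)]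
    simp only [measure_univ, Fintype.card_fin, zero_add, pow_one, Nat.cast_one, Real.sqrt_one]
    rw [hG, ← ENNReal.ofReal_mul hr.le, ← ENNReal.ofReal_mul (by positivity)]
    rw [show 1 / (2 * r) * (r * (√Real.pi / (√Real.pi / 2))) = 1 by field_simp]
    simp
  · have : Nonempty (Fin n) := ⟨⟨0, hn⟩⟩
    have h1 : volume {p : Fin n → ℝ | ∑ i, p i ^ 2 ≤ r ^ 2}
        = volume (Metric.closedBall (0 : EuclideanSpace ℝ (Fin n)) r) := by
      rw [← (PiLp.volume_preserving_ofLp (Fin n)).measure_preimage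
        (measurableSet_le (by fun_prop) (by fun_prop)).nullMeasurableSet]
      congr 1
      ext y
      simp only [Metric.mem_closedBall, dist_eq_norm, sub_zero, EuclideanSpace.norm_eq]
      rw [Real.sqrt_le_left hr.le]
      simp
    rw [h1, EuclideanSpace.volume_closedBall, EuclideanSpace.volume_closedBall]
    simp only [Fintype.card_fin]
    rw [← ENNReal.ofReal_pow hr.le, ← ENNReal.ofReal_pow hr.le,
      ← ENNReal.ofReal_mul (by positivity), ← ENNReal.ofReal_mul (by positivity),
      ← ENNReal.ofReal_mul (by positivity)]
    refine ENNReal.ofReal_le_ofReal ?_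
    set a : ℝ := (n : ℝ) / 2 + 1 with ha
    have ha0 : 0 < a := by positivity
    have hn1 : (1 : ℝ) ≤ n := by exact_mod_cast hn
    have hGa : 0 < Real.Gamma a := Real.Gamma_pos_of_pos ha0
    have hGb : 0 < Real.Gamma (a + 1 / 2) := Real.Gamma_pos_of_pos (by positivity)
    have hlog : Real.Gamma (a + 1 / 2) ^ 2 ≤ Real.Gamma a ^ 2 * a := by
      have h := Real.Gamma_mul_add_mul_le_rpow_Gamma_mul_rpow_Gamma ha0
        (show 0 < a + 1 by positivity) (show (0 : ℝ) < 1 / 2 by norm_num)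
        (show (0 : ℝ) < 1 / 2 by norm_num) (by norm_num)
      rw [show 1 / 2 * a + 1 / 2 * (a + 1) = a + 1 / 2 by ring, ← Real.sqrt_eq_rpow,
        ← Real.sqrt_eq_rpow, ← Real.sqrt_mul hGa.le, Real.Gamma_add_one ha0.ne'] at h
      calc _ ≤ √(Real.Gamma a * (a * Real.Gamma a)) ^ 2 := by gcongr
        _ = _ := by rw [Real.sq_sqrt (by positivity)]; ring
    have hpi : 0 < √Real.pi := by positivity
    have hpi2 : √Real.pi ^ 2 = Real.pi := Real.sq_sqrt Real.pi_pos.le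
    have key : 2 * Real.Gamma (a + 1 / 2) ≤ √((n + 1 : ℕ) : ℝ) * √Real.pi * Real.Gamma a := by
      refine abs_le_of_sq_le_sq' ?_ (by positivity) |>.2
      rw [mul_pow, mul_pow, mul_pow, hpi2, Real.sq_sqrt (by positivity)]
      have h4 : 4 * a ≤ (n + 1) * Real.pi := by
        have := Real.pi_gt_three
        nlinarith
      push_cast
      nlinarith [sq_nonneg (Real.Gamma a)]
    rw [show (((n + 1 : ℕ) : ℝ) / 2 + 1) = a + 1 / 2 by rw [ha]; push_cast; ring]
    rw [show √((n + 1 : ℕ) : ℝ) / (2 * r) * (r ^ (n + 1) * (√Real.pi ^ (n + 1) /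
        Real.Gamma (a + 1 / 2))) = r ^ n * (√Real.pi ^ n * ((√((n + 1 : ℕ) : ℝ) * √Real.pi) /
        (2 * Real.Gamma (a + 1 / 2)))) by field_simp; ring]
    gcongr r ^ n * ?_
    rw [div_eq_mul_inv]
    gcongr √Real.pi ^ n * ?_
    rw [inv_eq_one_div, div_le_div_iff₀ hGa (by positivity), one_mul]
    exact key

/-- Rotate the shift onto the first coordinate axis. -/
lemma volume_shift_diff {d : ℕ} (hd : 0 < d) {r : ℝ} (hr : 0 < r)
    (h : EuclideanSpace ℝ (Fin d)) :
    volume (Metric.closedBall h r \ Metric.closedBall 0 r)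
      ≤ ENNReal.ofReal (√(d : ℝ) / (2 * r) * ‖h‖) *
        volume (Metric.closedBall (0 : EuclideanSpace ℝ (Fin d)) r) := by
  obtain ⟨n, rfl⟩ : ∃ n, d = n + 1 := ⟨d - 1, by omega⟩
  obtain ⟨T, hT⟩ : ∃ T : EuclideanSpace ℝ (Fin (n + 1)) ≃ₗᵢ[ℝ] EuclideanSpace ℝ (Fin (n + 1)),
      T h = EuclideanSpace.single 0 ‖h‖ := by
    by_cases h0 : h = 0
    · refine ⟨LinearIsometryEquiv.refl ℝ _, ?_⟩
      subst h0
      ext i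
      simp
    · have hn : ‖h‖ ≠ 0 := norm_ne_zero_iff.2 h0
      have ho : Orthonormal ℝ (({0} : Set (Fin (n + 1))).domRestrict
          (fun _ => (‖h‖⁻¹ • h : EuclideanSpace ℝ (Fin (n + 1))))) := by
        refine ⟨fun i => ?_, fun i j hij => (hij (Subsingleton.elim _ _)).elim⟩
        simp [Set.domRestrict, norm_smul, hn]
      obtain ⟨b, hb⟩ := ho.exists_orthonormalBasis_extension_of_card_eq (by simp)
      refine ⟨b.repr, ?_⟩
      have h1 : h = ‖h‖ • b 0 := by rw [hb 0 rfl, smul_smul, mul_inv_cancel₀ hn, one_smul]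
      conv_lhs => rw [h1, map_smul, b.repr_self]
      ext i
      simp
  have hpre : Metric.closedBall h r \ Metric.closedBall 0 r
      = T ⁻¹' (Metric.closedBall (EuclideanSpace.single 0 ‖h‖) r \ Metric.closedBall 0 r) := by
    rw [← hT, Set.preimage_sdiff, T.preimage_closedBall, T.preimage_closedBall]
    simp
  rw [hpre, T.measurePreserving.measure_preimage (by measurability), mul_comm (_ / _),
    ENNReal.ofReal_mul (norm_nonneg h), mul_assoc]
  exact (volume_shift_single n hr.le (norm_nonneg h)).trans
    (by gcongr; exact volume_ball_ratio n hr)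

/-! ### A measurable gradient field for a random convex function -/

section Differentiability

open Filter Topology

variable {d : ℕ}

/-- Rademacher's theorem for convex functions. -/
lemma ae_differentiableAt_of_convexOn {U : Set (EuclideanSpace ℝ (Fin d))} (hU : IsOpen U)
    {h : EuclideanSpace ℝ (Fin d) → ℝ} (hh : ConvexOn ℝ U h) :
    ∀ᵐ v ∂volume.restrict U, DifferentiableAt ℝ h v := by
  rw [ae_restrict_iff' hU.measurableSet, ae_iff]
  refine measure_null_of_locally_null _ fun v hv => ?_
  have hvU : v ∈ U := by
    by_contra hc
    exact hv fun h => (hc h).elim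
  obtain ⟨K, t, ht, hK⟩ := hh.locallyLipschitzOn hU hvU
  rw [hU.nhdsWithin_eq hvU] at ht
  obtain ⟨W, hWt, hWo, hvW⟩ := mem_nhds_iff.1 ht
  have h1 := (hK.mono hWt).ae_differentiableWithinAt_of_mem (μ := volume)
  refine ⟨{v | ¬(v ∈ U → DifferentiableAt ℝ h v)} ∩ W,
    inter_mem self_mem_nhdsWithin (nhdsWithin_le_nhds (hWo.mem_nhds hvW)), ?_⟩
  refine measure_mono_null ?_ (ae_iff.1 h1)
  rintro w ⟨hw1, hw2⟩ hw3
  exact hw1 fun _ => (hw3 hw2).differentiableAt (hWo.mem_nhds hw2)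

lemma tendsto_slope_of_hasFDerivAt {h : EuclideanSpace ℝ (Fin d) → ℝ}
    {h' : EuclideanSpace ℝ (Fin d) →L[ℝ] ℝ} {v : EuclideanSpace ℝ (Fin d)}
    (hd : HasFDerivAt h h' v) (e : EuclideanSpace ℝ (Fin d)) :
    Tendsto (fun n : ℕ => ((n : ℝ) + 1) * (h (v + ((n : ℝ) + 1)⁻¹ • e) - h v)) atTop
      (𝓝 (h' e)) := by
  have h0 := hd.lim_real e
  have h2 := h0.comp (tendsto_atTop_add_const_right _ (1 : ℝ) tendsto_natCast_atTop_atTop)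
  simpa [Function.comp_def] using h2

/-- The gradient of a convex function is a subgradient. -/
lemma add_fderiv_le_of_convexOn {D : Set (EuclideanSpace ℝ (Fin d))}
    {h : EuclideanSpace ℝ (Fin d) → ℝ} (hh : ConvexOn ℝ D h)
    {h' : EuclideanSpace ℝ (Fin d) →L[ℝ] ℝ} {v w : EuclideanSpace ℝ (Fin d)}
    (hd : HasFDerivAt h h' v) (hv : v ∈ D) (hw : w ∈ D) : h v + h' (w - v) ≤ h w := by
  suffices h' (w - v) ≤ h w - h v by linarith
  refine le_of_tendsto (tendsto_slope_of_hasFDerivAt hd (w - v)) (Eventually.of_forall fun n => ?_)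
  have hn : (0 : ℝ) < (n : ℝ) + 1 := by positivity
  have hn1 : ((n : ℝ) + 1)⁻¹ ≤ 1 := inv_le_one_of_one_le₀ (by linarith [n.cast_nonneg (α := ℝ)])
  have h1 := hh.2 hv hw (sub_nonneg.2 hn1) (inv_nonneg.2 hn.le) (by ring)
  rw [show (1 - ((n : ℝ) + 1)⁻¹) • v + ((n : ℝ) + 1)⁻¹ • w = v + ((n : ℝ) + 1)⁻¹ • (w - v) by
    module] at h1
  simp only [smul_eq_mul] at h1
  calc _ ≤ ((n : ℝ) + 1) * (((n : ℝ) + 1)⁻¹ * (h w - h v)) := by gcongr; linarith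
    _ = h w - h v := by field_simp

/-- A subgradient inequality that holds near the base point holds on the whole domain. -/
lemma le_of_le_on_open {D U : Set (EuclideanSpace ℝ (Fin d))} (hU : IsOpen U)
    {h : EuclideanSpace ℝ (Fin d) → ℝ} (hh : ConvexOn ℝ D h) {g v w : EuclideanSpace ℝ (Fin d)}
    (hvU : v ∈ U) (hvD : v ∈ D) (hg : ∀ w ∈ U, h v + ⟪g, w - v⟫ ≤ h w) (hw : w ∈ D) :
    h v + ⟪g, w - v⟫ ≤ h w := by
  have h1 : ∀ᶠ ε : ℝ in 𝓝[>] 0, v + ε • (w - v) ∈ U := by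
    have : ContinuousAt (fun ε : ℝ => v + ε • (w - v)) 0 := by fun_prop
    refine (this.mono_left nhdsWithin_le_nhds).eventually (hU.mem_nhds ?_)
    simpa using hvU
  have h2 : ∀ᶠ ε : ℝ in 𝓝[>] 0, ε ∈ Set.Ioo (0 : ℝ) 1 := Ioo_mem_nhdsGT one_pos
  obtain ⟨ε, hε1, hε0, hε2⟩ := (h1.and h2).exists
  have h3 := hg _ hε1
  have h4 := hh.2 hvD hw (sub_nonneg.2 hε2.le) hε0.le (by ring)
  rw [show (1 - ε) • v + ε • w = v + ε • (w - v) by module] at h4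
  rw [add_sub_cancel_left, inner_smul_right] at h3
  simp only [smul_eq_mul] at h4
  have : ε * (h v + ⟪g, w - v⟫) ≤ ε * h w := by linarith
  exact le_of_mul_le_mul_left this hε0

end Differentiability

open Filter Topology in
/-- A random convex function `F(·; s)` that is measurable in `s` has a jointly measurable field `Γ`
that is, off a null set of pairs `(v, s)`, the only subgradient. It is built from difference
quotients along the coordinate axes; `F` is first modified on a null set of samples, because only
the sections `F(v; ·)` are known to be (almost everywhere) measurable. -/
theorem exists_gradient_field {d : ℕ} {Ξ : Type*} [MeasurableSpace Ξ] (P : Measure Ξ)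
    {U : Set (EuclideanSpace ℝ (Fin d))} (hU : IsOpen U) (hUc : Convex ℝ U) (hUne : U.Nonempty)
    {F : EuclideanSpace ℝ (Fin d) → Ξ → ℝ} {D : Ξ → Set (EuclideanSpace ℝ (Fin d))}
    (hD : ∀ᵐ s ∂P, U ⊆ D s) (hF : ∀ᵐ s ∂P, ConvexOn ℝ (D s) fun v => F v s)
    (hmeas : ∀ v ∈ U, AEStronglyMeasurable (F v) P) :
    ∃ (Γ : EuclideanSpace ℝ (Fin d) × Ξ → EuclideanSpace ℝ (Fin d))
      (M : Set (EuclideanSpace ℝ (Fin d) × Ξ)), Measurable Γ ∧ MeasurableSet M ∧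
      (∀ v s, (v, s) ∈ M → Γ (v, s) ∈ subdifferential (D s) (fun w => F w s) v ∧
        ∀ g ∈ subdifferential (D s) (fun w => F w s) v, g = Γ (v, s)) ∧
      ∀ᵐ s ∂P, ∀ᵐ v ∂volume.restrict U, (v, s) ∈ M := by
  classical
  obtain ⟨v₀, hv₀⟩ := hUne
  set Q : ℕ → EuclideanSpace ℝ (Fin d) := TopologicalSpace.denseSeq _ with hQ
  have hQd : DenseRange Q := TopologicalSpace.denseRange_denseSeq _
  -- Measurable versions of the sections at countably many points.
  have hrep : ∀ n, ∃ f : Ξ → ℝ, Measurable f ∧ ∀ᵐ s ∂P, Q n ∈ U → F (Q n) s = f s := fun n => by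
    by_cases h : Q n ∈ U
    · refine ⟨(hmeas _ h).mk, (hmeas _ h).stronglyMeasurable_mk.measurable, ?_⟩
      filter_upwards [(hmeas _ h).ae_eq_mk] with s hs _ using hs
    · exact ⟨0, measurable_const, Eventually.of_forall fun _ h' => (h h').elim⟩
  choose f hfm hf using hrep
  obtain ⟨S₀, hS₀P, hS₀m, hS₀⟩ := ((hD.and hF).and (ae_all_iff.2 hf)).exists_measurable_mem
  have hFc : ∀ s ∈ S₀, ContinuousOn (fun v => F v s) U := fun s hs =>
    ((hS₀ s hs).1.2.subset (hS₀ s hs).1.1 hUc).continuousOn hU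
  -- `K` is continuous in the point and measurable in the sample.
  set K : U → Ξ → ℝ := fun v s => if s ∈ S₀ then F v s else 0 with hK
  have hKc : ∀ s, Continuous fun v => K v s := fun s => by
    by_cases hs : s ∈ S₀
    · simp only [hK, if_pos hs]
      exact continuousOn_iff_continuous_domRestrict.1 (hFc s hs)
    · simp only [hK, if_neg hs]
      exact continuous_const
  have hKm : ∀ v, Measurable (K v) := by
    rintro ⟨v, hv⟩
    have hcl : v ∈ closure (U ∩ Set.range Q) := hQd.open_subset_closure_inter hU hv
    obtain ⟨q, hq, hqv⟩ := mem_closure_iff_seq_limit.1 hcl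
    have hqv' : Tendsto (fun k => (⟨q k, (hq k).1⟩ : U)) atTop (𝓝 ⟨v, hv⟩) :=
      tendsto_subtype_rng.2 hqv
    refine measurable_of_tendsto_metrizable (f := fun k => K ⟨q k, (hq k).1⟩) (fun k => ?_)
      (tendsto_pi_nhds.2 fun s => ((hKc s).tendsto _).comp hqv')
    obtain ⟨n, hn⟩ := (hq k).2
    have : K ⟨q k, (hq k).1⟩ = fun s => if s ∈ S₀ then f n s else 0 := by
      ext s
      by_cases hs : s ∈ S₀
      · simp only [hK, if_pos hs]
        rw [← hn]
        exact (hS₀ s hs).2 n (hn ▸ (hq k).1)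
      · simp only [hK, if_neg hs]
    rw [this]
    exact Measurable.ite hS₀m (hfm n) measurable_const
  have hKu : Measurable (Function.uncurry K) :=
    (stronglyMeasurable_uncurry_of_continuous_of_stronglyMeasurable hKc
      fun v => (hKm v).stronglyMeasurable).measurable
  set r : EuclideanSpace ℝ (Fin d) → U := fun v => ⟨if v ∈ U then v else v₀, by
    split_ifs with h
    · exact h
    · exact hv₀⟩ with hr
  have hrm : Measurable r :=
    (Measurable.ite hU.measurableSet measurable_id measurable_const).subtype_mk
  set H : EuclideanSpace ℝ (Fin d) → Ξ → ℝ := fun v s => K (r v) s with hH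
  have hHm : Measurable (Function.uncurry H) :=
    hKu.comp ((hrm.comp measurable_fst).prodMk measurable_snd)
  have hHm' : ∀ {φ : EuclideanSpace ℝ (Fin d) × Ξ → EuclideanSpace ℝ (Fin d)}, Measurable φ →
      Measurable fun p => H (φ p) p.2 := fun hφ => hHm.comp (hφ.prodMk measurable_snd)
  have hHF : ∀ v ∈ U, ∀ s ∈ S₀, H v s = F v s := fun v hv s hs => by
    simp [hH, hK, hr, hv, hs]
  set b : Fin d → EuclideanSpace ℝ (Fin d) := fun i => EuclideanSpace.single i 1 with hb
  set q : EuclideanSpace ℝ (Fin d) → ℕ → EuclideanSpace ℝ (Fin d) × Ξ → ℝ := fun e n p =>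
    ((n : ℝ) + 1) * (H (p.1 + ((n : ℝ) + 1)⁻¹ • e) p.2 - H p.1 p.2) with hq
  have hqm : ∀ e n, Measurable (q e n) := fun e n =>
    ((hHm' (by fun_prop)).sub (hHm' measurable_fst)).const_mul _
  set Γ : EuclideanSpace ℝ (Fin d) × Ξ → EuclideanSpace ℝ (Fin d) := fun p =>
    WithLp.toLp 2 fun i => limsup (fun n => q (b i) n p) atTop with hΓ
  have hΓi : ∀ i, Measurable fun p => Γ p i := fun i => Measurable.limsup fun n => hqm (b i) n
  have hΓm : Measurable Γ :=
    (PiLp.continuous_toLp 2 _).measurable.comp (measurable_pi_lambda _ hΓi)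
  set M : Set (EuclideanSpace ℝ (Fin d) × Ξ) := {p | p.1 ∈ U} ∩ {p | p.2 ∈ S₀} ∩
    (⋂ i, {p | Tendsto (fun n => q (b i) n p) atTop (𝓝 (Γ p i))}) ∩
    (⋂ i, {p | Tendsto (fun n => q (-b i) n p) atTop (𝓝 (-Γ p i))}) ∩
    (⋂ n, {p | Q n ∈ U → H p.1 p.2 + ⟪Γ p, Q n - p.1⟫ ≤ H (Q n) p.2}) with hM
  have hMm : MeasurableSet M := by
    refine ((((measurable_fst hU.measurableSet).inter (measurable_snd hS₀m)).inter
      (MeasurableSet.iInter fun i => measurableSet_tendsto_fun (hqm _) (hΓi i))).inter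
      (MeasurableSet.iInter fun i => measurableSet_tendsto_fun (hqm _) (hΓi i).neg)).inter
      (MeasurableSet.iInter fun n => ?_)
    by_cases hn : Q n ∈ U
    · simp only [hn, true_imp_iff]
      exact measurableSet_le ((hHm' measurable_fst).add
        (hΓm.inner (measurable_const.sub measurable_fst))) (hHm' measurable_const)
    · simp [hn]
  refine ⟨Γ, M, hΓm, hMm, ?_, ?_⟩
  · rintro v s ⟨⟨⟨⟨hvU, hs⟩, h1⟩, h2⟩, h3⟩
    simp only [Set.mem_iInter, Set.mem_ofPred_eq] at hvU hs h1 h2 h3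
    have hUD := (hS₀ s hs).1.1
    have hcv := (hS₀ s hs).1.2
    refine ⟨⟨hUD hvU, fun w hw => le_of_le_on_open hU hcv hvU (hUD hvU) (fun w hw => ?_) hw⟩,
      fun g hg => ?_⟩
    · by_contra hc
      have ho : IsOpen (U ∩ {w | F w s - ⟪Γ (v, s), w - v⟫ < F v s}) := by
        have : ContinuousOn (fun w => F w s - ⟪Γ (v, s), w - v⟫) U :=
          (hFc s hs).sub (by fun_prop)
        exact this.isOpen_inter_preimage hU isOpen_Iio
      obtain ⟨n, hnU, hn⟩ := hQd.exists_mem_open ho ⟨w, hw, by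
        simp only [Set.mem_ofPred_eq]; linarith [not_le.1 hc]⟩
      have := h3 n hnU
      rw [hHF v hvU s hs, hHF _ hnU s hs] at this
      simp only [Set.mem_ofPred_eq] at hn
      linarith
    · have hev : ∀ e : EuclideanSpace ℝ (Fin d), ∀ᶠ n : ℕ in atTop, ⟪g, e⟫ ≤ q e n (v, s) := by
        intro e
        have ht : Tendsto (fun n : ℕ => v + ((n : ℝ) + 1)⁻¹ • e) atTop (𝓝 v) := by
          have h0 : Tendsto (fun n : ℕ => ((n : ℝ) + 1)⁻¹) atTop (𝓝 0) :=
            tendsto_inv_atTop_zero.comp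
              (tendsto_atTop_add_const_right _ (1 : ℝ) tendsto_natCast_atTop_atTop)
          simpa using (h0.smul_const e).const_add v
        filter_upwards [ht.eventually (hU.mem_nhds hvU)] with n hn
        have h4 := hg.2 _ (hUD hn)
        simp only [hq]
        rw [hHF _ hn s hs, hHF _ hvU s hs]
        rw [add_sub_cancel_left, inner_smul_right] at h4
        have hn0 : (0 : ℝ) < (n : ℝ) + 1 := by positivity
        calc ⟪g, e⟫ = ((n : ℝ) + 1) * (((n : ℝ) + 1)⁻¹ * ⟪g, e⟫) := by field_simp
          _ ≤ _ := by gcongr; linarith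
      ext i
      have h5 := ge_of_tendsto (h1 i) (hev (b i))
      have h6 := ge_of_tendsto (h2 i) (hev (-b i))
      simp only [hb, inner_neg_right, EuclideanSpace.inner_single_right, one_mul,
        conj_trivial] at h5 h6
      linarith
  · filter_upwards [hS₀P] with s hs
    have hcv := (hS₀ s hs).1.2.subset (hS₀ s hs).1.1 hUc
    filter_upwards [ae_differentiableAt_of_convexOn hU hcv, ae_restrict_mem hU.measurableSet]
      with v hv hvU
    have heq : (fun v => F v s) =ᶠ[𝓝 v] fun v => H v s := by
      filter_upwards [hU.mem_nhds hvU] with w hw using (hHF w hw s hs).symm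
    have hd := hv.hasFDerivAt
    have hd' := hd.congr_of_eventuallyEq heq.symm
    have hΓe : ∀ i, Γ (v, s) i = fderiv ℝ (fun v => F v s) v (b i) := fun i =>
      (tendsto_slope_of_hasFDerivAt hd' (b i)).limsup_eq
    have hΓin : ∀ e, ⟪Γ (v, s), e⟫ = fderiv ℝ (fun v => F v s) v e := fun e => by
      have he : e = ∑ i, e i • b i := by
        ext j; simp [hb, Pi.single_apply]
      conv_rhs => rw [he]
      simp only [map_sum, map_smul, ← hΓe, PiLp.inner_apply]
      simp
    refine ⟨⟨⟨⟨hvU, hs⟩, ?_⟩, ?_⟩, ?_⟩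
    · refine Set.mem_iInter.2 fun i => ?_
      simp only [Set.mem_ofPred_eq]
      rw [hΓe i]
      exact tendsto_slope_of_hasFDerivAt hd' (b i)
    · refine Set.mem_iInter.2 fun i => ?_
      simp only [Set.mem_ofPred_eq]
      rw [hΓe i, ← map_neg]
      exact tendsto_slope_of_hasFDerivAt hd' (-b i)
    · refine Set.mem_iInter.2 fun n hn => ?_
      simp only
      rw [hHF v hvU s hs, hHF _ hn s hs, hΓin]
      exact add_fderiv_le_of_convexOn hcv hd hvU hn

/-! ### Smoothing by the uniform distribution on a ball -/

section Smoothing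

open Filter Topology Metric

variable {d : ℕ}

instance : IsProbabilityMeasure (unifBall d) :=
  cond_isProbabilityMeasure_of_finite (measure_closedBall_pos volume _ one_pos).ne'
    measure_closedBall_lt_top.ne

lemma ae_unifBall_norm_le : ∀ᵐ z ∂unifBall d, ‖z‖ ≤ 1 := by
  have h : ∀ᵐ z ∂unifBall d, z ∈ closedBall (0 : EuclideanSpace ℝ (Fin d)) 1 :=
    ae_cond_mem measurableSet_closedBall
  filter_upwards [h] with z hz using by simpa using hz

lemma measurableEmbedding_affine {r : ℝ} (hr : 0 < r) (y : EuclideanSpace ℝ (Fin d)) :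
    MeasurableEmbedding fun z : EuclideanSpace ℝ (Fin d) => y + r • z :=
  ((Homeomorph.smulOfNeZero r hr.ne').trans (Homeomorph.addLeft y)).measurableEmbedding

lemma map_unifBall {r : ℝ} (hr : 0 < r) (y : EuclideanSpace ℝ (Fin d)) :
    (unifBall d).map (fun z => y + r • z) = cond volume (closedBall y r) := by
  have he := measurableEmbedding_affine hr y
  ext s hs
  rw [he.map_apply, unifBall, cond_apply measurableSet_closedBall,
    cond_apply measurableSet_closedBall]
  have h1 : closedBall 0 1 ∩ (fun z => y + r • z) ⁻¹' s
      = (r • ·) ⁻¹' ((y + ·) ⁻¹' (closedBall y r ∩ s)) := by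
    ext z
    have : r * ‖z‖ ≤ r ↔ ‖z‖ ≤ 1 := by
      constructor
      · intro h; by_contra hc; nlinarith
      · intro h; nlinarith
    simp [norm_smul, abs_of_pos hr, this]
  rw [h1, Measure.addHaar_preimage_smul _ hr.ne', measure_preimage_add,
    Measure.addHaar_closedBall _ _ hr.le, Measure.addHaar_closedBall _ _ zero_le_one,
    abs_of_pos (by positivity), one_pow, ENNReal.ofReal_one, one_mul,
    ENNReal.ofReal_inv_of_pos (by positivity), ENNReal.mul_inv, ← mul_assoc]
  · rw [mul_comm (volume _)⁻¹]
  · left; simp [pow_pos hr]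
  · left; simp

lemma map_neg_unifBall : (unifBall d).map (fun z => -z) = unifBall d := by
  have h := (Measure.measurePreserving_neg (volume : Measure (EuclideanSpace ℝ (Fin d))))
  ext s hs
  rw [Measure.map_apply measurable_neg hs, unifBall, cond_apply measurableSet_closedBall,
    cond_apply measurableSet_closedBall]
  congr 1
  rw [← h.measure_preimage (measurableSet_closedBall.inter hs).nullMeasurableSet]
  congr 1
  ext z
  simp

/-- The sphere is a null set, so the open ball suffices in the hypothesis. -/
lemma ae_cond_closedBall_of_ae_restrict {U : Set (EuclideanSpace ℝ (Fin d))}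
    {p : EuclideanSpace ℝ (Fin d) → Prop} {r : ℝ} (hr : 0 < r) {y : EuclideanSpace ℝ (Fin d)}
    (hU : IsOpen U) (hy : ball y r ⊆ U) (hp : ∀ᵐ v ∂volume.restrict U, p v) :
    ∀ᵐ v ∂volume.restrict (closedBall y r), v ∈ U ∧ p v := by
  rw [ae_restrict_iff' hU.measurableSet] at hp
  rw [ae_restrict_iff' measurableSet_closedBall]
  have h2 : ∀ᵐ v ∂(volume : Measure (EuclideanSpace ℝ (Fin d))), v ∉ sphere y r := by
    exact measure_eq_zero_iff_ae_notMem.1 (Measure.addHaar_sphere_of_ne_zero volume y hr.ne')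
  filter_upwards [hp, h2] with v h1 h2 h3
  have : v ∈ U := hy ((mem_closedBall.1 h3).lt_of_ne fun h => h2 h)
  exact ⟨this, h1 this⟩

lemma ae_unifBall_of_ae_restrict {U : Set (EuclideanSpace ℝ (Fin d))}
    {p : EuclideanSpace ℝ (Fin d) → Prop} {r : ℝ} (hr : 0 < r) {y : EuclideanSpace ℝ (Fin d)}
    (hU : IsOpen U) (hy : ball y r ⊆ U) (hp : ∀ᵐ v ∂volume.restrict U, p v) :
    ∀ᵐ z ∂unifBall d, y + r • z ∈ U ∧ p (y + r • z) := by
  have h1 : ∀ᵐ v ∂(unifBall d).map (fun z => y + r • z), v ∈ U ∧ p v := by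
    rw [map_unifBall hr]
    exact Measure.ae_smul_measure (ae_cond_closedBall_of_ae_restrict hr hU hy hp) _
  exact ((measurableEmbedding_affine hr y).ae_map_iff).1 h1

lemma map_unifBall_absolutelyContinuous {U : Set (EuclideanSpace ℝ (Fin d))} {r : ℝ} (hr : 0 < r)
    {y : EuclideanSpace ℝ (Fin d)} (hU : IsOpen U) (hy : ball y r ⊆ U) :
    (unifBall d).map (fun z => y + r • z) ≪ volume.restrict U := by
  refine Measure.AbsolutelyContinuous.mk fun s hs h0 => ?_
  rw [Measure.map_apply (measurableEmbedding_affine hr y).measurable hs]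
  have := ae_unifBall_of_ae_restrict hr hU hy (p := fun v => v ∉ s)
    (measure_eq_zero_iff_ae_notMem.1 h0)
  exact measure_eq_zero_iff_ae_notMem.2 (this.mono fun z hz => hz.2)

lemma integral_unifBall {r : ℝ} (hr : 0 < r) (y : EuclideanSpace ℝ (Fin d))
    {G : Type*} [NormedAddCommGroup G] [NormedSpace ℝ G] (k : EuclideanSpace ℝ (Fin d) → G) :
    ∫ z, k (y + r • z) ∂unifBall d
      = (volume.real (closedBall (0 : EuclideanSpace ℝ (Fin d)) r))⁻¹ •
        ∫ v in closedBall y r, k v := by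
  rw [← (measurableEmbedding_affine hr y).integral_map, map_unifBall hr, ProbabilityTheory.cond,
    integral_smul_measure, ENNReal.toReal_inv, Measure.addHaar_closedBall _ _ hr.le,
    measureReal_def, Measure.addHaar_closedBall _ _ hr.le]

lemma volume_real_closedBall_diff (hd : 0 < d) {r : ℝ} (hr : 0 < r)
    (w y : EuclideanSpace ℝ (Fin d)) :
    volume.real (closedBall w r \ closedBall y r)
      ≤ √(d : ℝ) / (2 * r) * ‖w - y‖ *
        volume.real (closedBall (0 : EuclideanSpace ℝ (Fin d)) r) := by
  have h1 : closedBall (w - y) r \ closedBall 0 r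
      = (y + ·) ⁻¹' (closedBall w r \ closedBall y r) := by
    ext v
    simp [dist_eq_norm, sub_sub_eq_add_sub]
  have h := volume_shift_diff hd hr (w - y)
  rw [h1, measure_preimage_add] at h
  have h2 := ENNReal.toReal_mono
    (ENNReal.mul_ne_top ENNReal.ofReal_ne_top measure_closedBall_lt_top.ne) h
  rwa [ENNReal.toReal_mul, ENNReal.toReal_ofReal (by positivity)] at h2

/-- The smoothed function `y ↦ E[f(y + r Z)]`, with `Z` uniform on the unit ball. -/
noncomputable def smoothed (f : EuclideanSpace ℝ (Fin d) → ℝ) (r : ℝ)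
    (y : EuclideanSpace ℝ (Fin d)) : ℝ := ∫ z, f (y + r • z) ∂unifBall d

/-- The averaged subgradient `y ↦ E[γ(y + r Z)]`, with `Z` uniform on the unit ball. -/
noncomputable def smoothedGrad (γ : EuclideanSpace ℝ (Fin d) → EuclideanSpace ℝ (Fin d)) (r : ℝ)
    (y : EuclideanSpace ℝ (Fin d)) : EuclideanSpace ℝ (Fin d) := ∫ z, γ (y + r • z) ∂unifBall d

/-- `f` is convex on the open convex set `U`, and `γ` is a measurable field that is, at almost
every point of `U`, a subgradient of `f` of norm at most `L₀`. -/
structure HasBoundedSubgradients (U : Set (EuclideanSpace ℝ (Fin d))) (L₀ : ℝ)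
    (f : EuclideanSpace ℝ (Fin d) → ℝ) (γ : EuclideanSpace ℝ (Fin d) → EuclideanSpace ℝ (Fin d)) :
    Prop where
  isOpen : IsOpen U
  convexOn : ConvexOn ℝ U f
  nonneg : 0 ≤ L₀
  measurable : Measurable γ
  norm_le : ∀ᵐ v ∂volume.restrict U, ‖γ v‖ ≤ L₀
  subgradient : ∀ᵐ v ∂volume.restrict U, ∀ w ∈ U, f v + ⟪γ v, w - v⟫ ≤ f w

namespace HasBoundedSubgradients

variable {U : Set (EuclideanSpace ℝ (Fin d))} {L₀ : ℝ} {f : EuclideanSpace ℝ (Fin d) → ℝ}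
  {γ : EuclideanSpace ℝ (Fin d) → EuclideanSpace ℝ (Fin d)} {r : ℝ}
  {w y : EuclideanSpace ℝ (Fin d)}

lemma continuousOn (H : HasBoundedSubgradients U L₀ f γ) : ContinuousOn f U :=
  H.convexOn.continuousOn H.isOpen

lemma sub_le (H : HasBoundedSubgradients U L₀ f γ) (hw : w ∈ U) (hy : y ∈ U) :
    f w - f y ≤ L₀ * ‖w - y‖ := by
  -- The inequality holds at almost every `w`, hence everywhere by continuity.
  by_contra hc
  have ho : IsOpen (U ∩ {v | 0 < f v - f y - L₀ * ‖v - y‖}) :=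
    ((H.continuousOn.sub continuousOn_const).sub (by fun_prop)).isOpen_inter_preimage H.isOpen
      isOpen_Ioi
  have hpos := ho.measure_pos volume ⟨w, hw, by simp only [Set.mem_ofPred_eq]; linarith⟩
  refine hpos.ne' ?_
  have h1 := (ae_restrict_iff' H.isOpen.measurableSet).1 (H.norm_le.and H.subgradient)
  refine measure_mono_null ?_ (ae_iff.1 h1)
  rintro v ⟨hv, hv1⟩ hv2
  obtain ⟨h3, h4⟩ := hv2 hv
  have h5 := h4 y hy
  have h6 := abs_le.1 (abs_real_inner_le_norm (γ v) (y - v))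
  have h7 : ‖γ v‖ * ‖y - v‖ ≤ L₀ * ‖v - y‖ := by rw [norm_sub_rev]; gcongr
  simp only [Set.mem_ofPred_eq] at hv1
  linarith [h6.1]

lemma abs_sub_le (H : HasBoundedSubgradients U L₀ f γ) (hw : w ∈ U) (hy : y ∈ U) :
    |f w - f y| ≤ L₀ * ‖w - y‖ :=
  abs_le.2 ⟨by have := H.sub_le hy hw; rw [norm_sub_rev] at this; linarith, H.sub_le hw hy⟩

lemma ae_mem (H : HasBoundedSubgradients U L₀ f γ) (hr : 0 < r) (hy : ball y r ⊆ U) :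
    ∀ᵐ z ∂unifBall d, y + r • z ∈ U :=
  (ae_unifBall_of_ae_restrict hr H.isOpen hy (p := fun _ => True) (by simp)).mono fun _ h => h.1

lemma ae_abs_sub_le (H : HasBoundedSubgradients U L₀ f γ) (hr : 0 < r) (hy : ball y r ⊆ U) :
    ∀ᵐ z ∂unifBall d, |f (y + r • z) - f y| ≤ L₀ * r := by
  filter_upwards [H.ae_mem hr hy, ae_unifBall_norm_le] with z hz hz1
  refine (H.abs_sub_le hz (hy (mem_ball_self hr))).trans ?_
  rw [add_sub_cancel_left, norm_smul, Real.norm_of_nonneg hr.le]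
  have := H.nonneg
  gcongr
  nlinarith

lemma integrable_comp (H : HasBoundedSubgradients U L₀ f γ) (hr : 0 < r) (hy : ball y r ⊆ U) :
    Integrable (fun z => f (y + r • z)) (unifBall d) := by
  have h1 : AEStronglyMeasurable (fun z => f (y + r • z)) (unifBall d) :=
    ((H.continuousOn.aestronglyMeasurable H.isOpen.measurableSet).mono_ac
      (map_unifBall_absolutelyContinuous hr H.isOpen hy)).comp_measurable
      (measurableEmbedding_affine hr y).measurable
  refine Integrable.of_bound h1 (|f y| + L₀ * r) ?_
  filter_upwards [H.ae_abs_sub_le hr hy] with z hz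
  rw [Real.norm_eq_abs]
  calc |f (y + r • z)| = |f y + (f (y + r • z) - f y)| := by congr 1; ring
    _ ≤ |f y| + |f (y + r • z) - f y| := abs_add_le _ _
    _ ≤ _ := by gcongr

lemma integrable_grad_comp (H : HasBoundedSubgradients U L₀ f γ) (hr : 0 < r)
    (hy : ball y r ⊆ U) : Integrable (fun z => γ (y + r • z)) (unifBall d) := by
  refine Integrable.of_bound (H.measurable.comp
    (measurableEmbedding_affine hr y).measurable).aestronglyMeasurable L₀ ?_
  exact (ae_unifBall_of_ae_restrict hr H.isOpen hy H.norm_le).mono fun _ h => h.2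

lemma smoothed_le (H : HasBoundedSubgradients U L₀ f γ) (hr : 0 < r) (hy : ball y r ⊆ U) :
    smoothed f r y ≤ f y + L₀ * r := by
  have h := integral_mono_ae (H.integrable_comp hr hy) (integrable_const (f y + L₀ * r))
    ((H.ae_abs_sub_le hr hy).mono fun z hz => by
      simp only; linarith [(abs_le.1 hz).2])
  simpa [smoothed] using h

lemma le_smoothed (H : HasBoundedSubgradients U L₀ f γ) (hr : 0 < r) (hy : ball y r ⊆ U) :
    f y ≤ smoothed f r y := by
  -- Average over the antipodal pairs `y ± r z`.
  have hI := H.integrable_comp hr hy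
  have hneg : ∫ z, f (y + r • -z) ∂unifBall d = smoothed f r y := by
    rw [smoothed]
    conv_rhs => rw [← map_neg_unifBall]
    exact (((MeasurableEquiv.neg _).measurableEmbedding).integral_map
      (fun z => f (y + r • z))).symm
  have hIn : Integrable (fun z => f (y + r • -z)) (unifBall d) := by
    rw [← map_neg_unifBall] at hI
    exact ((MeasurableEquiv.neg _).measurableEmbedding.integrable_map_iff).1 hI
  have hmn : ∀ᵐ z ∂unifBall d, y + r • -z ∈ U := by
    have h := H.ae_mem hr hy
    rw [← map_neg_unifBall] at h
    exact ((MeasurableEquiv.neg _).measurableEmbedding.ae_map_iff).1 h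
  have h := integral_mono_ae (integrable_const (f y))
    ((hI.const_mul (1 / 2)).add (hIn.const_mul (1 / 2))) (by
      filter_upwards [H.ae_mem hr hy, hmn] with z h1 h2
      have := H.convexOn.2 h1 h2 (show (0 : ℝ) ≤ 1 / 2 by norm_num)
        (show (0 : ℝ) ≤ 1 / 2 by norm_num) (by norm_num)
      rw [show (1 / 2 : ℝ) • (y + r • z) + (1 / 2 : ℝ) • (y + r • -z) = y by module] at this
      simpa using this)
  simp only [Pi.add_apply] at h
  rw [integral_add (hI.const_mul _) (hIn.const_mul _), integral_const_mul, integral_const_mul,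
    hneg, ← smoothed] at h
  simp only [integral_const, probReal_univ, smul_eq_mul] at h
  linarith

lemma smoothed_mono (H : HasBoundedSubgradients U L₀ f γ) {r' : ℝ} (hr' : 0 < r') (hrr : r' ≤ r)
    (hy : ball y r ⊆ U) : smoothed f r' y ≤ smoothed f r y := by
  have hr : 0 < r := hr'.trans_le hrr
  have hyU := hy (mem_ball_self hr)
  have hq : r' / r ≤ 1 := (div_le_one hr).2 hrr
  have hq0 : 0 ≤ r' / r := by positivity
  have h := integral_mono_ae (H.integrable_comp hr' ((ball_subset_ball hrr).trans hy))
    ((integrable_const ((1 - r' / r) * f y)).add ((H.integrable_comp hr hy).const_mul (r' / r))) (by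
      filter_upwards [H.ae_mem hr hy] with z h1
      have := H.convexOn.2 hyU h1 (sub_nonneg.2 hq) hq0 (by ring)
      rw [show (1 - r' / r) • y + (r' / r) • (y + r • z) = y + ((r' / r) * r) • z by module,
        div_mul_cancel₀ _ hr.ne'] at this
      simpa using this)
  rw [integral_add' (integrable_const _) ((H.integrable_comp hr hy).const_mul _),
    integral_const, integral_const_mul, probReal_univ, one_smul] at h
  have h2 := H.le_smoothed hr hy
  rw [smoothed]
  rw [smoothed] at h2 ⊢
  nlinarith [mul_le_mul_of_nonneg_left h2 (sub_nonneg.2 hq)]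

lemma smoothed_subgradient (H : HasBoundedSubgradients U L₀ f γ) (hr : 0 < r)
    (hy : ball y r ⊆ U) (hw : ball w r ⊆ U) :
    smoothed f r y + ⟪smoothedGrad γ r y, w - y⟫ ≤ smoothed f r w := by
  have hg := H.integrable_grad_comp hr hy
  rw [smoothed, smoothedGrad, real_inner_comm, ← integral_inner hg,
    ← integral_add (H.integrable_comp hr hy) (hg.const_inner _)]
  refine integral_mono_ae ((H.integrable_comp hr hy).add (hg.const_inner _))
    (H.integrable_comp hr hw) ?_
  filter_upwards [ae_unifBall_of_ae_restrict hr H.isOpen hy H.subgradient, H.ae_mem hr hw]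
    with z h1 h2
  have := h1.2 _ h2
  rwa [show w + r • z - (y + r • z) = w - y by abel, real_inner_comm] at this

lemma norm_smoothedGrad_le (H : HasBoundedSubgradients U L₀ f γ) (hr : 0 < r)
    (hy : ball y r ⊆ U) : ‖smoothedGrad γ r y‖ ≤ L₀ := by
  have h := norm_integral_le_of_norm_le_const
    ((ae_unifBall_of_ae_restrict hr H.isOpen hy H.norm_le).mono fun _ h => h.2)
  simpa [smoothedGrad] using h

lemma norm_smoothedGrad_sub_le (H : HasBoundedSubgradients U L₀ f γ) (hd : 0 < d) (hr : 0 < r)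
    (hy : ball y r ⊆ U) (hw : ball w r ⊆ U) :
    ‖smoothedGrad γ r w - smoothedGrad γ r y‖ ≤ L₀ * √(d : ℝ) / r * ‖w - y‖ := by
  have hb : ∀ {x}, ball x r ⊆ U → ∀ᵐ v ∂volume.restrict (closedBall x r), ‖γ v‖ ≤ L₀ :=
    fun hx => (ae_cond_closedBall_of_ae_restrict hr H.isOpen hx H.norm_le).mono fun _ h => h.2
  have hI : ∀ {x}, ball x r ⊆ U → IntegrableOn γ (closedBall x r) := fun hx =>
    IntegrableOn.of_bound measure_closedBall_lt_top H.measurable.aestronglyMeasurable L₀ (hb hx)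
  have hV : 0 < volume.real (closedBall (0 : EuclideanSpace ℝ (Fin d)) r) :=
    ENNReal.toReal_pos (measure_closedBall_pos _ _ hr).ne' measure_closedBall_lt_top.ne
  set V := volume.real (closedBall (0 : EuclideanSpace ℝ (Fin d)) r) with hVdef
  have hdiff : ∀ {x x'}, ball x r ⊆ U →
      ‖∫ v in closedBall x r \ closedBall x' r, γ v‖ ≤ L₀ * (√(d : ℝ) / (2 * r) * ‖x - x'‖ * V) := by
    intro x x' hx
    refine (norm_setIntegral_le_of_norm_le_const_ae'
      ((measure_mono Set.sdiff_subset).trans_lt measure_closedBall_lt_top) (C := L₀) ?_).trans ?_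
    · have := (ae_restrict_iff' measurableSet_closedBall).1 (hb hx)
      filter_upwards [this] with v hv hv1 using hv hv1.1
    · have := H.nonneg
      gcongr
      exact volume_real_closedBall_diff hd hr x x'
  have e : smoothedGrad γ r w - smoothedGrad γ r y = V⁻¹ •
      ((∫ v in closedBall w r \ closedBall y r, γ v)
        - ∫ v in closedBall y r \ closedBall w r, γ v) := by
    rw [smoothedGrad, smoothedGrad, integral_unifBall hr, integral_unifBall hr, ← smul_sub,
      ← integral_inter_add_sdiff (t := closedBall y r) measurableSet_closedBall (hI hw),
      ← integral_inter_add_sdiff (t := closedBall w r) measurableSet_closedBall (hI hy),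
      Set.inter_comm (closedBall y r), add_sub_add_left_eq_sub]
  rw [e, norm_smul, Real.norm_of_nonneg (inv_nonneg.2 hV.le)]
  have h1 := norm_sub_le (∫ v in closedBall w r \ closedBall y r, γ v)
    (∫ v in closedBall y r \ closedBall w r, γ v)
  have h2 := hdiff hw (x' := y)
  have h3 := hdiff hy (x' := w)
  rw [norm_sub_rev y w] at h3
  calc _ ≤ V⁻¹ * (L₀ * (√(d : ℝ) / (2 * r) * ‖w - y‖ * V)
        + L₀ * (√(d : ℝ) / (2 * r) * ‖w - y‖ * V)) := by gcongr; linarith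
    _ = _ := by field_simp; ring

/-- The descent lemma for the smoothed function. Subdividing the segment from `y` to `w` into `n`
pieces and bounding the increment over each by the subgradient at its far end gives the estimate
with an error `O(1 / n)`; no differentiability of the smoothed function is needed. -/
lemma smoothed_descent (H : HasBoundedSubgradients U L₀ f γ) (hd : 0 < d) (hr : 0 < r)
    (hy : ball y r ⊆ U) (hw : ball w r ⊆ U) :
    smoothed f r w ≤ smoothed f r y + ⟪smoothedGrad γ r y, w - y⟫
      + L₀ * √(d : ℝ) / r / 2 * ‖w - y‖ ^ 2 := by
  set h := w - y with hh
  set Λ := L₀ * √(d : ℝ) / r with hΛ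
  have hΛ0 : 0 ≤ Λ := by have := H.nonneg; positivity
  set S := smoothed f r y
  set c := ⟪smoothedGrad γ r y, h⟫ with hc
  have hseg : ∀ s ∈ Set.Icc (0 : ℝ) 1, ball (y + s • h) r ⊆ U := by
    intro s hs v hv
    have h1 : y + (v - (y + s • h)) ∈ U := hy (by simpa [dist_eq_norm] using hv)
    have h2 : w + (v - (y + s • h)) ∈ U := hw (by simpa [dist_eq_norm] using hv)
    have h3 := H.convexOn.1 h1 h2 (sub_nonneg.2 hs.2) hs.1 (by ring)
    convert h3 using 1
    rw [hh]; module
  have hn : ∀ n : ℕ, smoothed f r w ≤ S + c + Λ / 2 * ‖h‖ ^ 2 + Λ / 2 * ‖h‖ ^ 2 / (n + 1) := by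
    intro n
    have hn0 : (0 : ℝ) < (n : ℝ) + 1 := by positivity
    set p : ℕ → EuclideanSpace ℝ (Fin d) := fun k => y + ((k : ℝ) / (n + 1)) • h with hp
    have hpU : ∀ k ≤ n + 1, ball (p k) r ⊆ U := fun k hk => hseg _
      ⟨by positivity, by rw [div_le_one hn0]; exact_mod_cast hk⟩
    have hind : ∀ k ≤ n + 1, smoothed f r (p k) ≤ S + k / (n + 1) * c
        + Λ * ‖h‖ ^ 2 * (k * (k + 1) / 2) / (n + 1) ^ 2 := by
      intro k
      induction k with
      | zero => intro _; simp [hp, S]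
      | succ k ih =>
        intro hk
        have ih' := ih (by omega)
        have h1 := H.smoothed_subgradient hr (hpU _ hk) (hpU k (by omega))
        have h2 := H.norm_smoothedGrad_sub_le hd hr hy (hpU _ hk)
        have e1 : p k - p (k + 1) = -((1 / ((n : ℝ) + 1)) • h) := by
          simp only [hp]; push_cast; module
        have e2 : p (k + 1) - y = (((k + 1 : ℕ) : ℝ) / (n + 1)) • h := by simp [hp]
        rw [e1, inner_neg_right, inner_smul_right] at h1
        rw [e2, norm_smul, Real.norm_of_nonneg (by positivity)] at h2
        have h3 := real_inner_le_norm (smoothedGrad γ r (p (k + 1)) - smoothedGrad γ r y) h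
        rw [inner_sub_left] at h3
        have h4 : ⟪smoothedGrad γ r (p (k + 1)), h⟫
            ≤ c + Λ * (((k + 1 : ℕ) : ℝ) / (n + 1) * ‖h‖) * ‖h‖ := by
          have := mul_le_mul_of_nonneg_right h2 (norm_nonneg h)
          linarith
        have h5 := mul_le_mul_of_nonneg_left h4 (show 0 ≤ 1 / ((n : ℝ) + 1) by positivity)
        refine (show _ ≤ _ from by linarith : smoothed f r (p (k + 1)) ≤
          (S + k / (n + 1) * c + Λ * ‖h‖ ^ 2 * (k * (k + 1) / 2) / (n + 1) ^ 2)
          + 1 / ((n : ℝ) + 1) * (c + Λ * (((k + 1 : ℕ) : ℝ) / (n + 1) * ‖h‖) * ‖h‖)).trans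
          (le_of_eq ?_)
        push_cast
        field_simp
        ring
    have h6 := hind (n + 1) le_rfl
    have e3 : p (n + 1) = w := by
      simp only [hp, hh]; push_cast; rw [div_self hn0.ne']; module
    rw [e3] at h6
    refine h6.trans (le_of_eq ?_)
    push_cast
    field_simp
    ring
  have ht : Tendsto (fun n : ℕ => S + c + Λ / 2 * ‖h‖ ^ 2 + Λ / 2 * ‖h‖ ^ 2 / ((n : ℝ) + 1)) atTop
      (𝓝 (S + c + Λ / 2 * ‖h‖ ^ 2 + 0)) :=
    tendsto_const_nhds.add (tendsto_const_nhds.div_atTop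
      (tendsto_atTop_add_const_right _ (1 : ℝ) tendsto_natCast_atTop_atTop))
  rw [add_zero] at ht
  exact ge_of_tendsto' ht hn

end HasBoundedSubgradients

end Smoothing

/-! ### Proximal functions and dual averaging steps -/

section Prox

variable {d : ℕ} {X : Set (EuclideanSpace ℝ (Fin d))} {φ ψ : EuclideanSpace ℝ (Fin d) → ℝ}

lemma IsProxFunction.strong (hψ : IsProxFunction X ψ) (hX : Convex ℝ X)
    {x y : EuclideanSpace ℝ (Fin d)} (hx : x ∈ X) (hy : y ∈ X) {a b : ℝ} (ha : 0 ≤ a) (hb : 0 ≤ b)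
    (hab : a + b = 1) :
    ψ (a • x + b • y) + a * b / 2 * ‖x - y‖ ^ 2 ≤ a * ψ x + b * ψ y := by
  obtain ⟨G, hG⟩ := hψ.strongly_convex
  set p := a • x + b • y with hp
  have hpX : p ∈ X := hX hx hy ha hb hab
  have h1 := (hG p hpX).2 x hx
  have h2 := (hG p hpX).2 y hy
  have e1 : x - p = b • (x - y) := by
    rw [hp, show b = 1 - a by linarith]; module
  have e2 : y - p = (-a) • (x - y) := by
    rw [hp, show b = 1 - a by linarith]; module
  rw [norm_sub_rev, e1, norm_smul, inner_smul_right, Real.norm_eq_abs, mul_pow, sq_abs] at h1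
  rw [norm_sub_rev, e2, norm_smul, inner_smul_right, Real.norm_eq_abs, mul_pow, sq_abs] at h2
  have h3 := mul_le_mul_of_nonneg_left h1 ha
  have h4 := mul_le_mul_of_nonneg_left h2 hb
  have hb' : b = 1 - a := by linarith
  subst hb'
  linarith

/-- The objective `⟪s, v⟫ + A φ(v) + B ψ(v)` of a dual averaging step. -/
noncomputable def stepObjective (φ ψ : EuclideanSpace ℝ (Fin d) → ℝ) (A B : ℝ)
    (s v : EuclideanSpace ℝ (Fin d)) : ℝ := ⟪s, v⟫ + A * φ v + B * ψ v

lemma stepObjective_growth (hφ : ConvexOn ℝ X φ) (hψ : IsProxFunction X ψ) {A B : ℝ} (hA : 0 ≤ A)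
    (hB : 0 ≤ B) {s z v : EuclideanSpace ℝ (Fin d)} (hz : z ∈ X)
    (hmin : IsMinOn (stepObjective φ ψ A B s) X z) (hv : v ∈ X) :
    stepObjective φ ψ A B s z + B / 2 * ‖v - z‖ ^ 2 ≤ stepObjective φ ψ A B s v := by
  -- Compare `z` with `z + ε (v - z)` and let `ε → 0`.
  have key : ∀ ε ∈ Set.Ioo (0 : ℝ) 1, stepObjective φ ψ A B s z
      + (1 - ε) * (B / 2 * ‖v - z‖ ^ 2) ≤ stepObjective φ ψ A B s v := by
    intro ε hε
    have h1 := hψ.strong hφ.1 hv hz hε.1.le (sub_nonneg.2 hε.2.le) (by ring)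
    have h2 := hφ.2 hv hz hε.1.le (sub_nonneg.2 hε.2.le) (by ring)
    have h3 := isMinOn_iff.1 hmin _ (hφ.1 hv hz hε.1.le (sub_nonneg.2 hε.2.le) (by ring))
    simp only [stepObjective, inner_add_right, inner_smul_right, smul_eq_mul] at h2 h3 ⊢
    have h4 := mul_le_mul_of_nonneg_left h1 hB
    have h5 := mul_le_mul_of_nonneg_left h2 hA
    refine le_of_mul_le_mul_left (a := ε) ?_ hε.1
    linarith
  have ht : Filter.Tendsto (fun ε : ℝ => stepObjective φ ψ A B s z
      + (1 - ε) * (B / 2 * ‖v - z‖ ^ 2)) (nhdsWithin 0 (Set.Ioi 0))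
      (nhds (stepObjective φ ψ A B s z + (1 - 0) * (B / 2 * ‖v - z‖ ^ 2))) := by
    refine Filter.Tendsto.mono_left ?_ nhdsWithin_le_nhds
    exact Continuous.tendsto (by fun_prop) 0
  rw [sub_zero, one_mul] at ht
  exact le_of_tendsto ht (Filter.eventually_of_mem (Ioo_mem_nhdsGT one_pos) key)

lemma norm_minimizer_sub_le (hφ : ConvexOn ℝ X φ) (hψ : IsProxFunction X ψ) {A B : ℝ} (hA : 0 ≤ A)
    (hB : 0 < B) {s s' z z' : EuclideanSpace ℝ (Fin d)} (hz : z ∈ X) (hz' : z' ∈ X)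
    (hmin : IsMinOn (stepObjective φ ψ A B s) X z)
    (hmin' : IsMinOn (stepObjective φ ψ A B s') X z') :
    ‖z - z'‖ ≤ B⁻¹ * ‖s - s'‖ := by
  have h1 := stepObjective_growth hφ hψ hA hB.le hz hmin hz'
  have h2 := stepObjective_growth hφ hψ hA hB.le hz' hmin' hz
  have h3 := real_inner_le_norm (s - s') (z' - z)
  rw [norm_sub_rev z' z] at h1 h3
  simp only [stepObjective, inner_sub_left, inner_sub_right] at h1 h2 h3
  have h4 : ‖z - z'‖ * (B * ‖z - z'‖) ≤ ‖z - z'‖ * ‖s - s'‖ := by linarith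
  rcases (norm_nonneg (z - z')).eq_or_lt with h0 | h0
  · rw [← h0]; positivity
  · have := le_of_mul_le_mul_left h4 h0
    rw [inv_mul_eq_div, le_div_iff₀ hB]
    linarith

/-- The minimizer of a dual averaging step is the value at the linear term `s` of one Lipschitz map,
defined on the whole space although a minimizer need not be known to exist for every `s`. -/
lemma exists_lipschitz_minimizer (hφ : ConvexOn ℝ X φ) (hψ : IsProxFunction X ψ) {A B : ℝ}
    (hA : 0 ≤ A) (hB : 0 < B) :
    ∃ (K : NNReal) (ζ : EuclideanSpace ℝ (Fin d) → EuclideanSpace ℝ (Fin d)), LipschitzWith K ζ ∧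
      ∀ s, ∀ z ∈ X, IsMinOn (stepObjective φ ψ A B s) X z → z = ζ s := by
  classical
  set S := {s | ∃ z ∈ X, IsMinOn (stepObjective φ ψ A B s) X z} with hS
  have hex : ∀ s, ∃ z, s ∈ S → z ∈ X ∧ IsMinOn (stepObjective φ ψ A B s) X z := fun s => by
    by_cases h : s ∈ S
    · obtain ⟨z, hz⟩ := h
      exact ⟨z, fun _ => hz⟩
    · exact ⟨0, fun h' => (h h').elim⟩
  choose ζ₀ hζ₀ using hex
  have hL : LipschitzOnWith ⟨B⁻¹, (inv_pos.2 hB).le⟩ ζ₀ S :=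
    LipschitzOnWith.of_dist_le_mul fun s hs s' hs' => by
      rw [dist_eq_norm, dist_eq_norm]
      exact norm_minimizer_sub_le hφ hψ hA hB (hζ₀ s hs).1 (hζ₀ s' hs').1 (hζ₀ s hs).2 (hζ₀ s' hs').2
  obtain ⟨ζ, hζ, hζe⟩ := hL.extend_finite_dimension
  refine ⟨_, ζ, hζ, fun s z hz hmin => ?_⟩
  have hs : s ∈ S := ⟨z, hz, hmin⟩
  rw [← hζe hs]
  have := norm_minimizer_sub_le hφ hψ hA hB hz (hζ₀ s hs).1 hmin (hζ₀ s hs).2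
  rw [sub_self, norm_zero, mul_zero] at this
  exact sub_eq_zero.1 (norm_le_zero_iff.1 this)

end Prox

/-! ### The potential argument along one sample path -/

section Path

variable {d : ℕ} {X : Set (EuclideanSpace ℝ (Fin d))} {φ ψ : EuclideanSpace ℝ (Fin d) → ℝ}

lemma acceleration_step {f : EuclideanSpace ℝ (Fin d) → ℝ} (hφ : ConvexOn ℝ X φ)
    {x y z x' z' G : EuclideanSpace ℝ (Fin d)} {θ L : ℝ} (hθ : 0 < θ) (hθ1 : θ ≤ 1)
    (hx : x ∈ X) (hz' : z' ∈ X)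
    (hy : y = (1 - θ) • x + θ • z) (hx' : x' = (1 - θ) • x + θ • z')
    (hdes : ∀ w ∈ X, f w ≤ f y + ⟪G, w - y⟫ + L / 2 * ‖w - y‖ ^ 2)
    (hsub : ∀ w ∈ X, f y + ⟪G, w - y⟫ ≤ f w) :
    (1 / θ) ^ 2 * (f x' + φ x') ≤ ((1 / θ) ^ 2 - 1 / θ) * (f x + φ x)
      + 1 / θ * (f y + ⟪G, z' - y⟫ + φ z') + L / 2 * ‖z' - z‖ ^ 2 := by
  have h1 := hφ.2 hx hz' (sub_nonneg.2 hθ1) hθ.le (by ring)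
  have h2 := hdes x' (by rw [hx']; exact hφ.1 hx hz' (sub_nonneg.2 hθ1) hθ.le (by ring))
  have h3 := mul_le_mul_of_nonneg_left (hsub x hx) (sub_nonneg.2 hθ1)
  have e1 : x' - y = θ • (z' - z) := by rw [hx', hy]; module
  have e2 : ⟪G, x' - y⟫ = (1 - θ) * ⟪G, x - y⟫ + θ * ⟪G, z' - y⟫ := by
    rw [show x' - y = (1 - θ) • (x - y) + θ • (z' - y) by rw [hx']; module, inner_add_right,
      inner_smul_right, inner_smul_right]
  rw [e2, e1, norm_smul, Real.norm_of_nonneg hθ.le, mul_pow] at h2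
  rw [← hx'] at h1
  simp only [smul_eq_mul] at h1
  have h4 : f x' + φ x' ≤ (1 - θ) * (f x + φ x) + θ * (f y + ⟪G, z' - y⟫ + φ z')
      + L / 2 * (θ ^ 2 * ‖z' - z‖ ^ 2) := by linarith
  refine (mul_le_mul_of_nonneg_left h4 (by positivity)).trans (le_of_eq ?_)
  field_simp

/-- Young's inequality for the part of the noise that is correlated with the step. -/
lemma inner_noise_le {e v : EuclideanSpace ℝ (Fin d)} {η : ℝ} (hη : 0 < η) :
    ⟪e, v⟫ - η / 2 * ‖v‖ ^ 2 ≤ ‖e‖ ^ 2 / (2 * η) := by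
  have h := real_inner_le_norm e v
  rw [le_div_iff₀ (by positivity)]
  nlinarith [sq_nonneg (‖e‖ - η * ‖v‖)]

/-- The error bound along a sample path. The first step is kept as it is: the starting point `z 0`
does not minimize the proximal function, so the quadratic term of the first step is not compensated
by strong convexity. -/
theorem path_bound (hφ : ConvexOn ℝ X φ) (hψ : IsProxFunction X ψ)
    {f : ℕ → EuclideanSpace ℝ (Fin d) → ℝ} {L η : ℕ → ℝ}
    {x y z g G : ℕ → EuclideanSpace ℝ (Fin d)} {xs : EuclideanSpace ℝ (Fin d)} (hxs : xs ∈ X)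
    (hL : ∀ t, 0 ≤ L t) (hη : ∀ t, 0 < η t)
    (hmono : ∀ t, L t + η t / theta t ≤ L (t + 1) + η (t + 1) / theta (t + 1))
    (hx : ∀ t, x t ∈ X) (hz : ∀ t, z t ∈ X)
    (hy : ∀ t, y t = (1 - theta t) • x t + theta t • z t)
    (hx' : ∀ t, x (t + 1) = (1 - theta t) • x t + theta t • z (t + 1))
    (hmin : ∀ t, IsMinOn (stepObjective φ ψ (∑ τ ∈ Finset.range (t + 1), 1 / theta τ)
      (L (t + 1) + η (t + 1) / theta (t + 1))
      (∑ τ ∈ Finset.range (t + 1), (1 / theta τ) • g τ)) X (z (t + 1)))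
    (hdes : ∀ t, ∀ w ∈ X, f t w ≤ f t (y t) + ⟪G t, w - y t⟫ + L t / 2 * ‖w - y t‖ ^ 2)
    (hsub : ∀ t, ∀ w ∈ X, f t (y t) + ⟪G t, w - y t⟫ ≤ f t w)
    (hf : ∀ t, ∀ w ∈ X, f (t + 1) w ≤ f t w) (T : ℕ) :
    (1 / theta T) ^ 2 * (f T (x (T + 1)) + φ (x (T + 1))) ≤
      (1 / theta T) ^ 2 * φ xs + (L (T + 1) + η (T + 1) / theta (T + 1)) * ψ xs
      + (f 0 (z 1) - ⟪g 0, z 1 - xs⟫ - (L 1 + η 1 / theta 1) * ψ (z 1))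
      + ∑ t ∈ Finset.range T, 1 / theta (t + 1) * (f (t + 1) xs
        + ⟪G (t + 1) - g (t + 1), z (t + 1) - xs⟫
        + ‖G (t + 1) - g (t + 1)‖ ^ 2 / (2 * η (t + 1))) := by
  set A : ℕ → ℝ := fun t => ∑ τ ∈ Finset.range (t + 1), 1 / theta τ with hA
  set B : ℕ → ℝ := fun t => L t + η t / theta t with hB
  set s : ℕ → EuclideanSpace ℝ (Fin d) := fun t =>
    ∑ τ ∈ Finset.range (t + 1), (1 / theta τ) • g τ with hs
  have hA0 : ∀ t, 0 ≤ A t := fun t => Finset.sum_nonneg fun τ _ => (one_div_theta_pos τ).le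
  have hB0 : ∀ t, 0 ≤ B t := fun t =>
    add_nonneg (hL t) (div_nonneg (hη t).le (theta_pos t).le)
  have main : ∀ T, (1 / theta T) ^ 2 * (f T (x (T + 1)) + φ (x (T + 1)))
      - stepObjective φ ψ (A T) (B (T + 1)) (s T) (z (T + 1)) ≤
      (f 0 (z 1) - ⟪g 0, z 1⟫ - B 1 * ψ (z 1))
      + ∑ t ∈ Finset.range T, 1 / theta (t + 1) * (f (t + 1) xs - ⟪g (t + 1), xs⟫
        + ⟪G (t + 1) - g (t + 1), z (t + 1) - xs⟫
        + ‖G (t + 1) - g (t + 1)‖ ^ 2 / (2 * η (t + 1))) := by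
    intro T
    induction T with
    | zero =>
      have : x 1 = z 1 := by rw [hx' 0]; simp [theta]
      simp [this, stepObjective, hA, hs, theta]
      linarith
    | succ t ih =>
      rw [Finset.sum_range_succ]
      have h1 := acceleration_step (f := f (t + 1)) hφ (theta_pos (t + 1)) (theta_le_one (t + 1))
        (hx (t + 1)) (hz (t + 2)) (hy (t + 1)) (hx' (t + 1)) (hdes (t + 1)) (hsub (t + 1))
      rw [inv_theta_succ_sq] at h1
      have h2 := mul_le_mul_of_nonneg_left (hf t _ (hx (t + 1))) (sq_nonneg (1 / theta t))
      have h3 := stepObjective_growth hφ hψ (hA0 t) (hB0 (t + 1)) (hz (t + 1)) (hmin t)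
        (hz (t + 2))
      have h4 := mul_le_mul_of_nonneg_right (hmono (t + 1)) (hψ.nonneg _ (hz (t + 2)))
      have h5 := hsub (t + 1) xs hxs
      have h6 := inner_noise_le (e := G (t + 1) - g (t + 1)) (v := z (t + 2) - z (t + 1))
        (hη (t + 1))
      have ha := one_div_theta_pos (t + 1)
      have h7 := mul_le_mul_of_nonneg_left h5 ha.le
      have h8 := mul_le_mul_of_nonneg_left h6 ha.le
      have eA : A (t + 1) = A t + 1 / theta (t + 1) := Finset.sum_range_succ _ _
      have es : s (t + 1) = s t + (1 / theta (t + 1)) • g (t + 1) := Finset.sum_range_succ _ _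
      rw [eA, es]
      simp only [stepObjective, inner_add_left, inner_sub_left, inner_sub_right, real_inner_smul_left,
        hB, div_eq_mul_one_div (η _) (theta _)] at *
      linarith
  have h1 := main T
  have h2 := isMinOn_iff.1 (hmin T) xs hxs
  have h3 : stepObjective φ ψ (A T) (B (T + 1)) (s T) xs = ⟪g 0, xs⟫
      + ∑ t ∈ Finset.range T, 1 / theta (t + 1) * ⟪g (t + 1), xs⟫
      + (1 / theta T) ^ 2 * φ xs + B (T + 1) * ψ xs := by
    have es : s T = ∑ t ∈ Finset.range T, (1 / theta (t + 1)) • g (t + 1) + (1 / theta 0) • g 0 :=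
      Finset.sum_range_succ' _ _
    rw [stepObjective, ← sum_inv_theta T, es, inner_add_left, sum_inner]
    simp only [real_inner_smul_left, theta, one_div_one, one_mul, hA]
    ring
  have h4 : ∀ t, 1 / theta (t + 1) * (f (t + 1) xs - ⟪g (t + 1), xs⟫
        + ⟪G (t + 1) - g (t + 1), z (t + 1) - xs⟫
        + ‖G (t + 1) - g (t + 1)‖ ^ 2 / (2 * η (t + 1)))
      = 1 / theta (t + 1) * (f (t + 1) xs + ⟪G (t + 1) - g (t + 1), z (t + 1) - xs⟫
        + ‖G (t + 1) - g (t + 1)‖ ^ 2 / (2 * η (t + 1)))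
        - 1 / theta (t + 1) * ⟪g (t + 1), xs⟫ := fun t => by ring
  simp only [h4, Finset.sum_sub_distrib] at h1
  have h5 : ⟪g 0, z 1 - xs⟫ = ⟪g 0, z 1⟫ - ⟪g 0, xs⟫ := inner_sub_right _ _ _
  have e1 : stepObjective φ ψ (A T) (B (T + 1)) (s T) (z (T + 1)) ≤
    stepObjective φ ψ (A T) (B (T + 1)) (s T) xs := h2
  rw [h3] at e1
  rw [h5]
  change _ ≤ _ + B (T + 1) * ψ xs + (_ - _ - B 1 * ψ (z 1)) + _
  linarith

/-- The first step from an arbitrary starting point. Strong convexity and nonnegativity of `ψ` give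
`‖z - x*‖² ≤ 4 ψ(z) + 4 ψ(x*)`, so a fraction of the proximal term absorbs the linear growth. -/
lemma first_step_le (hX : Convex ℝ X) (hψ : IsProxFunction X ψ)
    {z xs g : EuclideanSpace ℝ (Fin d)} (hz : z ∈ X) (hxs : xs ∈ X) {L₀ R B a b : ℝ}
    (hL₀ : 0 < L₀) (hR : 0 < R) (hψxs : ψ xs ≤ R ^ 2) (hB : L₀ / R ≤ B)
    (hab : a ≤ b + L₀ * ‖z - xs‖) :
    a - ⟪g, z - xs⟫ - B * ψ z ≤ b + ((2 * L₀ ^ 2 + 2 * ‖g‖ ^ 2) * (R / L₀) + L₀ * R) := by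
  set ρ := ‖z - xs‖
  have h1 := hψ.strong hX hz hxs (show (0 : ℝ) ≤ 1 / 2 by norm_num)
    (show (0 : ℝ) ≤ 1 / 2 by norm_num) (by norm_num)
  have h2 := hψ.nonneg _ (hX hz hxs (show (0 : ℝ) ≤ 1 / 2 by norm_num)
    (show (0 : ℝ) ≤ 1 / 2 by norm_num) (by norm_num))
  have h3 : ρ ^ 2 / 4 - R ^ 2 ≤ ψ z := by linarith
  have h4 : L₀ / R * (ρ ^ 2 / 4 - R ^ 2) ≤ B * ψ z :=
    (mul_le_mul_of_nonneg_left h3 (by positivity)).trans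
      (mul_le_mul_of_nonneg_right hB (hψ.nonneg z hz))
  have h5 := (abs_le.1 (abs_real_inner_le_norm g (z - xs))).1
  have h6 : (L₀ + ‖g‖) * ρ ≤ L₀ / R * (ρ ^ 2 / 4) + (2 * L₀ ^ 2 + 2 * ‖g‖ ^ 2) * (R / L₀) := by
    have e : (2 * L₀ ^ 2 + 2 * ‖g‖ ^ 2) * (R / L₀) + L₀ / R * (ρ ^ 2 / 4) - (L₀ + ‖g‖) * ρ
        = (R / L₀) * ((L₀ / R * ρ / 2 - (L₀ + ‖g‖)) ^ 2 + (L₀ - ‖g‖) ^ 2) := by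
      field_simp
      ring
    have : 0 ≤ (R / L₀) * ((L₀ / R * ρ / 2 - (L₀ + ‖g‖)) ^ 2 + (L₀ - ‖g‖) ^ 2) := by positivity
    linarith
  have e2 : L₀ / R * (ρ ^ 2 / 4 - R ^ 2) = L₀ / R * (ρ ^ 2 / 4) - L₀ * R := by field_simp
  linarith

end Path

/-! ### Second moments and independence -/

section Moments

variable {d : ℕ} {Ω 𝒲 𝒬 : Type*} [MeasurableSpace Ω] [MeasurableSpace 𝒲] [MeasurableSpace 𝒬]
  {Pr : Measure Ω} {ν : Measure 𝒲}

lemma memLp_two_of_lintegral_le {f : Ω → EuclideanSpace ℝ (Fin d)}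
    (hf : AEStronglyMeasurable f Pr) {C : ℝ} (h : ∫⁻ ω, ‖f ω‖ₑ ^ 2 ∂Pr ≤ ENNReal.ofReal (C ^ 2)) :
    MemLp f 2 Pr ∧ ∫ ω, ‖f ω‖ ^ 2 ∂Pr ≤ C ^ 2 := by
  refine ⟨⟨hf, ?_⟩, ?_⟩
  · rw [eLpNorm_lt_top_iff_lintegral_rpow_enorm_lt_top two_ne_zero ENNReal.ofNat_ne_top]
    simpa using h.trans_lt ENNReal.ofReal_lt_top
  · rw [integral_eq_lintegral_of_nonneg_ae (.of_forall fun _ => sq_nonneg _)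
      (by fun_prop)]
    refine ENNReal.toReal_le_of_le_ofReal (sq_nonneg C) (le_trans (le_of_eq ?_) h)
    congr 1
    ext ω
    rw [ENNReal.ofReal_pow (norm_nonneg _), ofReal_norm]

lemma integrable_norm_sq {f : Ω → EuclideanSpace ℝ (Fin d)} (hf : MemLp f 2 Pr) :
    Integrable (fun ω => ‖f ω‖ ^ 2) Pr :=
  (memLp_two_iff_integrable_sq_norm hf.1).1 hf

lemma integrable_inner_of_memLp_two {f g : Ω → EuclideanSpace ℝ (Fin d)} (hf : MemLp f 2 Pr)
    (hg : MemLp g 2 Pr) : Integrable (fun ω => ⟪f ω, g ω⟫) Pr := by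
  refine ((integrable_norm_sq hf).add (integrable_norm_sq hg)).mono' (hf.1.inner hg.1)
    (.of_forall fun ω => ?_)
  have h := norm_inner_le_norm (𝕜 := ℝ) (f ω) (g ω)
  simp only [Pi.add_apply]
  nlinarith [sq_nonneg (‖f ω‖ - ‖g ω‖), sq_nonneg (‖f ω‖ + ‖g ω‖)]

lemma lintegral_comp_indep [IsProbabilityMeasure Pr] [IsProbabilityMeasure ν] {q : Ω → 𝒬}
    {W : Ω → 𝒲} (hq : Measurable q) (hW : Measurable W) (hlaw : Pr.map W = ν)
    (hind : IndepFun q W Pr) {h : 𝒬 × 𝒲 → ℝ≥0∞} (hh : Measurable h) :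
    ∫⁻ ω, h (q ω, W ω) ∂Pr = ∫⁻ ω, ∫⁻ w, h (q ω, w) ∂ν ∂Pr := by
  rw [← lintegral_map (f := h) hh (hq.prodMk hW),
    (indepFun_iff_map_prod_eq_prod_map_map hq.aemeasurable hW.aemeasurable).1 hind, hlaw,
    lintegral_prod _ hh.aemeasurable, lintegral_map hh.lintegral_prod_right' hq]

lemma integral_comp_indep [IsProbabilityMeasure Pr] [IsProbabilityMeasure ν] {q : Ω → 𝒬}
    {W : Ω → 𝒲} (hq : Measurable q) (hW : Measurable W) (hlaw : Pr.map W = ν)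
    (hind : IndepFun q W Pr) {h : 𝒬 × 𝒲 → ℝ} (hh : Measurable h)
    (hi : Integrable (fun ω => h (q ω, W ω)) Pr) :
    ∫ ω, h (q ω, W ω) ∂Pr = ∫ ω, ∫ w, h (q ω, w) ∂ν ∂Pr := by
  have e := (indepFun_iff_map_prod_eq_prod_map_map hq.aemeasurable hW.aemeasurable).1 hind
  have hi' : Integrable h ((Pr.map q).prod ν) := by
    rw [← hlaw, ← e]
    exact (integrable_map_measure hh.aestronglyMeasurable (hq.prodMk hW).aemeasurable).2 hi
  have : IsProbabilityMeasure (Pr.map q) := Measure.isProbabilityMeasure_map hq.aemeasurable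
  rw [← integral_map (φ := fun ω => (q ω, W ω)) (f := h) (hq.prodMk hW).aemeasurable
    hh.aestronglyMeasurable, e, hlaw, integral_prod _ hi', integral_map hq.aemeasurable]
  exact hh.stronglyMeasurable.integral_prod_right'.aestronglyMeasurable

lemma ae_comp_indep [IsProbabilityMeasure Pr] [IsProbabilityMeasure ν] {q : Ω → 𝒬}
    {W : Ω → 𝒲} (hq : Measurable q) (hW : Measurable W) (hlaw : Pr.map W = ν)
    (hind : IndepFun q W Pr) {N : Set (𝒬 × 𝒲)} (hN : MeasurableSet N)
    (h : ∀ ω, ∀ᵐ w ∂ν, (q ω, w) ∈ N) : ∀ᵐ ω ∂Pr, (q ω, W ω) ∈ N := by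
  have h1 := lintegral_comp_indep hq hW hlaw hind (measurable_one.indicator hN.compl)
  have h2 : ∀ ω, ∫⁻ w, Nᶜ.indicator 1 (q ω, w) ∂ν = 0 := fun ω => by
    refine (lintegral_congr_ae ?_).trans lintegral_zero
    filter_upwards [h ω] with w hw
    exact Set.indicator_of_notMem (Set.notMem_compl_iff.2 hw) _
  simp only [h2, lintegral_zero] at h1
  have h3 := (lintegral_eq_zero_iff
    ((measurable_one.indicator hN.compl).comp (hq.prodMk hW))).1 h1
  filter_upwards [h3] with ω hω
  by_contra hc
  simp [Set.indicator_of_mem (Set.mem_compl hc)] at hω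

end Moments

/-! ### Unbiased oracles -/

/-- `k (y, w)` is the answer of a stochastic oracle queried at the point `y` of `X`, where `w` has
law `ν`; its second moment is at most `C²`. -/
structure IsOracle {d : ℕ} {𝒲 : Type*} [MeasurableSpace 𝒲] (ν : Measure 𝒲)
    (X : Set (EuclideanSpace ℝ (Fin d))) (C : ℝ)
    (k : EuclideanSpace ℝ (Fin d) × 𝒲 → EuclideanSpace ℝ (Fin d)) : Prop where
  measurable : Measurable k
  moment : ∀ y ∈ X, ∫⁻ w, ‖k (y, w)‖ₑ ^ 2 ∂ν ≤ ENNReal.ofReal (C ^ 2)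

/-- The mean answer of an oracle at `y`. -/
noncomputable def oracleMean {d : ℕ} {𝒲 : Type*} [MeasurableSpace 𝒲] (ν : Measure 𝒲)
    (k : EuclideanSpace ℝ (Fin d) × 𝒲 → EuclideanSpace ℝ (Fin d))
    (y : EuclideanSpace ℝ (Fin d)) : EuclideanSpace ℝ (Fin d) := ∫ w, k (y, w) ∂ν

namespace IsOracle

variable {d : ℕ} {Ω 𝒲 𝒬 : Type*} [MeasurableSpace Ω] [MeasurableSpace 𝒲] [MeasurableSpace 𝒬]
  {Pr : Measure Ω} {ν : Measure 𝒲} {X : Set (EuclideanSpace ℝ (Fin d))} {C : ℝ}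
  {k : EuclideanSpace ℝ (Fin d) × 𝒲 → EuclideanSpace ℝ (Fin d)}

lemma memLp (O : IsOracle ν X C k) {y : EuclideanSpace ℝ (Fin d)} (hy : y ∈ X) :
    MemLp (fun w => k (y, w)) 2 ν :=
  (memLp_two_of_lintegral_le (O.measurable.comp measurable_prodMk_left).aestronglyMeasurable
    (O.moment y hy)).1

variable [IsProbabilityMeasure Pr] [IsProbabilityMeasure ν]

lemma integrable (O : IsOracle ν X C k) {y : EuclideanSpace ℝ (Fin d)} (hy : y ∈ X) :
    Integrable (fun w => k (y, w)) ν :=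
  (O.memLp hy).integrable one_le_two

lemma measurable_mean (O : IsOracle ν X C k) : Measurable (oracleMean ν k) :=
  (O.measurable.stronglyMeasurable.integral_prod_right').measurable

lemma norm_mean_le (O : IsOracle ν X C k) {y : EuclideanSpace ℝ (Fin d)} (hy : y ∈ X) :
    ‖oracleMean ν k y‖ ≤ 1 + C ^ 2 := by
  have h := memLp_two_of_lintegral_le (f := fun w => k (y, w))
    (O.measurable.comp (measurable_prodMk_left (x := y))).aestronglyMeasurable (O.moment y hy)
  calc ‖oracleMean ν k y‖ ≤ ∫ w, ‖k (y, w)‖ ∂ν := norm_integral_le_integral_norm _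
    _ ≤ ∫ w, (1 + ‖k (y, w)‖ ^ 2) ∂ν := integral_mono (O.integrable hy).norm
        ((integrable_const 1).add (integrable_norm_sq h.1)) fun w => by
          simp only; nlinarith [sq_nonneg (‖k (y, w)‖ - 1), norm_nonneg (k (y, w))]
    _ ≤ 1 + C ^ 2 := by
        rw [integral_add (integrable_const 1) (integrable_norm_sq h.1)]
        simpa using h.2

variable {p b : Ω → EuclideanSpace ℝ (Fin d)} {W : Ω → 𝒲}

lemma memLp_comp (O : IsOracle ν X C k) (hp : Measurable p) (hpX : ∀ ω, p ω ∈ X)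
    (hW : Measurable W) (hlaw : Pr.map W = ν) (hind : IndepFun p W Pr) :
    MemLp (fun ω => k (p ω, W ω)) 2 Pr ∧ ∫ ω, ‖k (p ω, W ω)‖ ^ 2 ∂Pr ≤ C ^ 2 := by
  refine memLp_two_of_lintegral_le (f := fun ω => k (p ω, W ω))
    (O.measurable.comp (hp.prodMk hW)).aestronglyMeasurable ?_
  rw [lintegral_comp_indep hp hW hlaw hind (h := fun x => ‖k x‖ₑ ^ 2)
    (O.measurable.enorm.pow_const 2)]
  refine (lintegral_mono fun ω => O.moment _ (hpX ω)).trans ?_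
  simp

lemma memLp_mean_comp (O : IsOracle ν X C k) (hp : Measurable p) (hpX : ∀ ω, p ω ∈ X) :
    MemLp (fun ω => oracleMean ν k (p ω)) 2 Pr :=
  MemLp.of_bound (O.measurable_mean.comp hp).aestronglyMeasurable _
    (.of_forall fun ω => O.norm_mean_le (hpX ω))

/-- The noise of the oracle is orthogonal to everything independent of its randomness. -/
lemma integral_inner_noise (O : IsOracle ν X C k) (hp : Measurable p) (hpX : ∀ ω, p ω ∈ X)
    (hb : Measurable b) (hb2 : MemLp b 2 Pr) (hW : Measurable W) (hlaw : Pr.map W = ν)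
    (hind : IndepFun (fun ω => (p ω, b ω)) W Pr) :
    ∫ ω, ⟪oracleMean ν k (p ω) - k (p ω, W ω), b ω⟫ ∂Pr = 0 := by
  have hk := O.memLp_comp hp hpX hW hlaw (hind.comp measurable_fst measurable_id)
  have hG := O.memLp_mean_comp (Pr := Pr) hp hpX
  have hm : Measurable fun x : (EuclideanSpace ℝ (Fin d) × EuclideanSpace ℝ (Fin d)) × 𝒲 =>
      ⟪k (x.1.1, x.2), x.1.2⟫ :=
    (O.measurable.comp ((measurable_fst.comp measurable_fst).prodMk measurable_snd)).inner
      (measurable_snd.comp measurable_fst)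
  have h := integral_comp_indep (hp.prodMk hb) hW hlaw hind hm
    (integrable_inner_of_memLp_two hk.1 hb2)
  simp only at h
  simp only [inner_sub_left]
  rw [integral_sub (integrable_inner_of_memLp_two hG hb2)
    (integrable_inner_of_memLp_two hk.1 hb2), h, sub_eq_zero]
  refine integral_congr_ae (.of_forall fun ω => ?_)
  simp only [oracleMean]
  rw [real_inner_comm, ← integral_inner (O.integrable (hpX ω))]
  simp only [real_inner_comm]

lemma integral_norm_sq_noise_le (O : IsOracle ν X C k) (hp : Measurable p) (hpX : ∀ ω, p ω ∈ X)
    (hW : Measurable W) (hlaw : Pr.map W = ν) (hind : IndepFun p W Pr) :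
    ∫ ω, ‖oracleMean ν k (p ω) - k (p ω, W ω)‖ ^ 2 ∂Pr ≤ C ^ 2 := by
  have hk := O.memLp_comp hp hpX hW hlaw hind
  have hG := O.memLp_mean_comp (Pr := Pr) hp hpX
  have h0 := O.integral_inner_noise hp hpX (O.measurable_mean.comp hp) hG hW hlaw
    (hind.comp (measurable_id.prodMk O.measurable_mean) measurable_id)
  have hi := integrable_inner_of_memLp_two (hG.sub hk.1) hG
  -- `‖G - k‖² = ‖k‖² - ‖G‖² + 2 ⟪G - k, G⟫`
  have e : ∀ ω, ‖oracleMean ν k (p ω) - k (p ω, W ω)‖ ^ 2 ≤ ‖k (p ω, W ω)‖ ^ 2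
      + 2 * ⟪oracleMean ν k (p ω) - k (p ω, W ω), oracleMean ν k (p ω)⟫ := fun ω => by
    rw [norm_sub_sq_real, inner_sub_left, real_inner_self_eq_norm_sq,
      real_inner_comm (oracleMean ν k (p ω))]
    nlinarith [sq_nonneg ‖oracleMean ν k (p ω)‖]
  refine (integral_mono (integrable_norm_sq (hG.sub hk.1))
    ((integrable_norm_sq hk.1).add (hi.const_mul 2)) e).trans ?_
  have hadd := integral_add (integrable_norm_sq hk.1) (hi.const_mul 2)
  simp only [Pi.add_apply, Pi.sub_apply] at hadd ⊢
  rw [hadd, integral_const_mul]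
  simp only [Function.comp_apply] at h0
  rw [h0]
  linarith [hk.2]

end IsOracle

/-! ### Averages over a batch of independent queries -/

section Batch

variable {d : ℕ} {Ω 𝒲 ι : Type*} [m𝒲 : MeasurableSpace 𝒲]

/-- The σ-algebra generated by the variables `W p` with `p ∈ S`. -/
abbrev sampleSigma (W : ι → Ω → 𝒲) (S : Set ι) : MeasurableSpace Ω :=
  ⨆ p ∈ S, MeasurableSpace.comap (W p) m𝒲

lemma sampleSigma_mono (W : ι → Ω → 𝒲) {S S' : Set ι} (h : S ⊆ S') :
    sampleSigma W S ≤ sampleSigma W S' :=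
  biSup_mono h

lemma measurable_sample (W : ι → Ω → 𝒲) {S : Set ι} {p : ι} (hp : p ∈ S) :
    Measurable[sampleSigma W S] (W p) :=
  Measurable.mono (comap_measurable (W p))
    (le_iSup₂ (f := fun p (_ : p ∈ S) => MeasurableSpace.comap (W p) m𝒲) p hp) le_rfl

variable {ν : Measure 𝒲} {k : EuclideanSpace ℝ (Fin d) × 𝒲 → EuclideanSpace ℝ (Fin d)}
  {p b : Ω → EuclideanSpace ℝ (Fin d)}

/-- The error of the average of `m` independent oracle answers at the same random point. -/
noncomputable def batchNoise {m : ℕ} (ν : Measure 𝒲)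
    (k : EuclideanSpace ℝ (Fin d) × 𝒲 → EuclideanSpace ℝ (Fin d))
    (p : Ω → EuclideanSpace ℝ (Fin d)) (V : Fin m → Ω → 𝒲) (ω : Ω) : EuclideanSpace ℝ (Fin d) :=
  oracleMean ν k (p ω) - (1 / (m : ℝ)) • ∑ i, k (p ω, V i ω)

lemma batchNoise_eq {m : ℕ} (hm : 0 < m) (V : Fin m → Ω → 𝒲) (ω : Ω) :
    batchNoise ν k p V ω = (1 / (m : ℝ)) • ∑ i, (oracleMean ν k (p ω) - k (p ω, V i ω)) := by
  have : (m : ℝ) ≠ 0 := by positivity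
  rw [batchNoise, Finset.sum_sub_distrib, smul_sub]
  simp only [Finset.sum_const, Finset.card_univ, Fintype.card_fin]
  rw [← Nat.cast_smul_eq_nsmul ℝ, smul_smul, one_div_mul_cancel this, one_smul]

variable [mΩ : MeasurableSpace Ω] {Pr : Measure Ω}

lemma sampleSigma_le {W : ι → Ω → 𝒲} (hW : ∀ p, Measurable (W p)) (S : Set ι) :
    sampleSigma W S ≤ mΩ :=
  iSup₂_le fun p _ => (hW p).comap_le

lemma indepFun_sample {𝒬 : Type*} [MeasurableSpace 𝒬] {W : ι → Ω → 𝒲}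
    (hW : ∀ p, Measurable (W p)) (hind : iIndepFun W Pr) {S : Set ι} {p : ι} (hp : p ∉ S)
    {q : Ω → 𝒬} (hq : Measurable[sampleSigma W S] q) : IndepFun q (W p) Pr := by
  have h := indep_iSup_of_disjoint (fun p => (hW p).comap_le)
    ((iIndepFun_iff_iIndep _ _ _).1 hind) (Set.disjoint_singleton_right.2 hp)
  rw [IndepFun_iff_Indep]
  refine indep_of_indep_of_le_left (indep_of_indep_of_le_right h ?_) hq.comap_le
  simp

variable [IsProbabilityMeasure Pr] [IsProbabilityMeasure ν]
  {X : Set (EuclideanSpace ℝ (Fin d))} {C : ℝ} {W : ι → Ω → 𝒲} {S : Set ι}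
  {m : ℕ} {j : Fin m → ι}

lemma IsOracle.memLp_batchNoise (O : IsOracle ν X C k) (hm : 0 < m) (hW : ∀ p, Measurable (W p))
    (hlaw : ∀ p, Pr.map (W p) = ν) (hind : iIndepFun W Pr) (hj : ∀ i, j i ∉ S)
    (hp : Measurable[sampleSigma W S] p) (hpX : ∀ ω, p ω ∈ X) :
    MemLp (batchNoise ν k p fun i => W (j i)) 2 Pr := by
  have hp' : Measurable p := hp.mono (sampleSigma_le hW S) le_rfl
  have := (memLp_finsetSum' (p := 2) (μ := Pr) Finset.univ fun i _ =>
    (O.memLp_mean_comp (Pr := Pr) hp' hpX).sub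
      (O.memLp_comp hp' hpX (hW (j i)) (hlaw _) (indepFun_sample hW hind (hj i) hp)).1).const_smul
      (1 / (m : ℝ))
  refine this.ae_eq (.of_forall fun ω => ?_)
  rw [batchNoise_eq hm]
  simp

lemma IsOracle.integral_inner_batchNoise (O : IsOracle ν X C k) (hm : 0 < m)
    (hW : ∀ p, Measurable (W p)) (hlaw : ∀ p, Pr.map (W p) = ν) (hind : iIndepFun W Pr)
    (hj : ∀ i, j i ∉ S) (hp : Measurable[sampleSigma W S] p) (hpX : ∀ ω, p ω ∈ X)
    (hb : Measurable[sampleSigma W S] b) (hb2 : MemLp b 2 Pr) :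
    ∫ ω, ⟪batchNoise ν k p (fun i => W (j i)) ω, b ω⟫ ∂Pr = 0 := by
  have hp' : Measurable p := hp.mono (sampleSigma_le hW S) le_rfl
  have hb' : Measurable b := hb.mono (sampleSigma_le hW S) le_rfl
  simp only [batchNoise_eq hm, real_inner_smul_left, sum_inner]
  have haL : ∀ i, MemLp (fun ω => oracleMean ν k (p ω) - k (p ω, W (j i) ω)) 2 Pr := fun i =>
    (O.memLp_mean_comp (Pr := Pr) hp' hpX).sub
      (O.memLp_comp hp' hpX (hW (j i)) (hlaw _) (indepFun_sample hW hind (hj i) hp)).1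
  rw [integral_const_mul,
    integral_finsetSum _ fun i _ => integrable_inner_of_memLp_two (haL i) hb2,
    Finset.sum_eq_zero, mul_zero]
  intro i _
  exact O.integral_inner_noise hp' hpX hb' hb2 (hW _) (hlaw _)
    (indepFun_sample hW hind (hj i) (hp.prodMk hb))

/-- Averaging over a batch divides the variance by its size: the cross terms vanish, since the noise
of one query is independent of the randomness of another. -/
lemma IsOracle.integral_norm_sq_batchNoise_le (O : IsOracle ν X C k) (hm : 0 < m)
    (hW : ∀ p, Measurable (W p)) (hlaw : ∀ p, Pr.map (W p) = ν) (hind : iIndepFun W Pr)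
    (hj : ∀ i, j i ∉ S) (hji : Function.Injective j)
    (hp : Measurable[sampleSigma W S] p) (hpX : ∀ ω, p ω ∈ X) :
    ∫ ω, ‖batchNoise ν k p (fun i => W (j i)) ω‖ ^ 2 ∂Pr ≤ C ^ 2 / m := by
  have hp' : Measurable p := hp.mono (sampleSigma_le hW S) le_rfl
  have hm0 : (0 : ℝ) < m := by exact_mod_cast hm
  set a : Fin m → Ω → EuclideanSpace ℝ (Fin d) := fun i ω =>
    oracleMean ν k (p ω) - k (p ω, W (j i) ω) with ha
  have haL : ∀ i, MemLp (a i) 2 Pr := fun i => (O.memLp_mean_comp (Pr := Pr) hp' hpX).sub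
      (O.memLp_comp hp' hpX (hW (j i)) (hlaw _) (indepFun_sample hW hind (hj i) hp)).1
  have e : ∀ ω, ‖batchNoise ν k p (fun i => W (j i)) ω‖ ^ 2
      = (1 / (m : ℝ)) ^ 2 * ∑ i, ∑ l, ⟪a i ω, a l ω⟫ := fun ω => by
    rw [batchNoise_eq hm, norm_smul, mul_pow, Real.norm_of_nonneg (by positivity),
      ← real_inner_self_eq_norm_sq (∑ i, _), sum_inner]
    simp only [inner_sum, ha]
  simp only [e]
  rw [integral_const_mul, integral_finsetSum _ fun i _ => integrable_finsetSum _ fun l _ =>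
    integrable_inner_of_memLp_two (haL i) (haL l)]
  have hrow : ∀ i, ∫ ω, ∑ l, ⟪a i ω, a l ω⟫ ∂Pr ≤ C ^ 2 := fun i => by
    rw [integral_finsetSum _ fun l _ => integrable_inner_of_memLp_two (haL i) (haL l),
      Finset.sum_eq_single i]
    · simp only [real_inner_self_eq_norm_sq]
      exact O.integral_norm_sq_noise_le hp' hpX (hW _) (hlaw _)
        (indepFun_sample hW hind (hj i) hp)
    · intro l _ hli
      have hS : j i ∉ insert (j l) S := by
        simp only [Set.mem_insert_iff, not_or]
        exact ⟨fun h => hli (hji h).symm, hj i⟩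
      have hpS : Measurable[sampleSigma W (insert (j l) S)] p :=
        hp.mono (sampleSigma_mono W (Set.subset_insert _ _)) le_rfl
      have haS : Measurable[sampleSigma W (insert (j l) S)] (a l) :=
        (O.measurable_mean.comp hpS).sub
          (O.measurable.comp (hpS.prodMk (measurable_sample W (Set.mem_insert _ _))))
      exact O.integral_inner_noise hp' hpX (haS.mono (sampleSigma_le hW _) le_rfl) (haL l) (hW _)
        (hlaw _) (indepFun_sample hW hind hS (hpS.prodMk haS))
    · simp
  calc (1 / (m : ℝ)) ^ 2 * ∑ i, ∫ ω, ∑ l, ⟪a i ω, a l ω⟫ ∂Pr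
      ≤ (1 / (m : ℝ)) ^ 2 * ∑ _i : Fin m, C ^ 2 := by gcongr with i; exact hrow i
    _ = C ^ 2 / m := by simp; field_simp

end Batch

/-! ### Adaptedness and moments of the iterates -/

section Iterates

lemma notMem_past {m : ℕ} (t : ℕ) (i : Fin m) : (i, t) ∉ {q : Fin m × ℕ | q.2 < t} := by
  simp

variable {d m : ℕ} {Ω 𝒲 : Type*} [mΩ : MeasurableSpace Ω] [m𝒲 : MeasurableSpace 𝒲]

/-- `f` is square integrable and almost surely equal to a function of the variables `W (i, τ)` with
`τ < t`. -/
def IsAdapted (W : Fin m × ℕ → Ω → 𝒲) (Pr : Measure Ω) (t : ℕ)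
    (f : Ω → EuclideanSpace ℝ (Fin d)) : Prop :=
  AEStronglyMeasurable[sampleSigma W {q | q.2 < t}] f Pr ∧ MemLp f 2 Pr

namespace IsAdapted

variable {W : Fin m × ℕ → Ω → 𝒲} {Pr : Measure Ω} {t : ℕ} {f f' : Ω → EuclideanSpace ℝ (Fin d)}

lemma mono (h : IsAdapted W Pr t f) {t' : ℕ} (ht : t ≤ t') : IsAdapted W Pr t' f :=
  ⟨h.1.mono (sampleSigma_mono W fun _ hq => lt_of_lt_of_le hq ht), h.2⟩

lemma add (h : IsAdapted W Pr t f) (h' : IsAdapted W Pr t f') :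
    IsAdapted W Pr t fun ω => f ω + f' ω :=
  ⟨h.1.add h'.1, h.2.add h'.2⟩

lemma const_smul (h : IsAdapted W Pr t f) (c : ℝ) : IsAdapted W Pr t fun ω => c • f ω :=
  ⟨h.1.const_smul c, h.2.const_smul c⟩

lemma congr (h : IsAdapted W Pr t f) (hf : f =ᵐ[Pr] f') : IsAdapted W Pr t f' :=
  ⟨h.1.congr hf, h.2.ae_eq hf⟩

lemma const [IsFiniteMeasure Pr] (c : EuclideanSpace ℝ (Fin d)) :
    IsAdapted W Pr t fun _ => c :=
  ⟨aestronglyMeasurable_const, memLp_const c⟩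

lemma sum [IsFiniteMeasure Pr] {α : Type*} (s : Finset α)
    {F : α → Ω → EuclideanSpace ℝ (Fin d)} (h : ∀ i ∈ s, IsAdapted W Pr t (F i)) :
    IsAdapted W Pr t fun ω => ∑ i ∈ s, F i ω := by
  classical
  induction s using Finset.induction_on with
  | empty => simpa using const 0
  | insert a s ha ih =>
    simp only [Finset.sum_insert ha]
    exact (h a (Finset.mem_insert_self a s)).add
      (ih fun i hi => h i (Finset.mem_insert_of_mem hi))

lemma comp_lipschitz [IsFiniteMeasure Pr] (h : IsAdapted W Pr t f) {K : NNReal}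
    {ζ : EuclideanSpace ℝ (Fin d) → EuclideanSpace ℝ (Fin d)} (hζ : LipschitzWith K ζ) :
    IsAdapted W Pr t fun ω => ζ (f ω) := by
  refine ⟨hζ.continuous.comp_aestronglyMeasurable h.1, ?_⟩
  have h0 : LipschitzWith K fun s => ζ s - ζ 0 :=
    LipschitzWith.of_dist_le_mul fun a b => by simpa using hζ.dist_le_mul a b
  have h1 := (h0.comp_memLp (by simp) h.2).add (memLp_const (ζ 0))
  refine h1.ae_eq (.of_forall fun ω => ?_)
  simp

/-- An adapted variable with values in `X` has a version that takes values in `X` everywhere. -/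
lemma exists_version (h : IsAdapted W Pr t f) {X : Set (EuclideanSpace ℝ (Fin d))}
    (hX : MeasurableSet X) (hne : X.Nonempty) (hf : ∀ᵐ ω ∂Pr, f ω ∈ X) :
    ∃ p : Ω → EuclideanSpace ℝ (Fin d), Measurable[sampleSigma W {q | q.2 < t}] p ∧
      (∀ ω, p ω ∈ X) ∧ p =ᵐ[Pr] f := by
  classical
  obtain ⟨x₀, hx₀⟩ := hne
  have hm := h.1.stronglyMeasurable_mk.measurable
  refine ⟨fun ω => if h.1.mk f ω ∈ X then h.1.mk f ω else x₀,
    Measurable.ite (hm hX) hm measurable_const, fun ω => ?_, ?_⟩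
  · simp only
    split_ifs with h1
    · exact h1
    · exact hx₀
  · filter_upwards [h.1.ae_eq_mk, hf] with ω h1 h2
    rw [← h1, if_pos h2]

end IsAdapted

/-- A run of accelerated dual averaging with abstract stochastic oracles: at time `t` the answers to
the queries at `y t` are `k t (y t, W (i, t))`, almost surely. -/
structure IsOracleRun (ν : Measure 𝒲) (X : Set (EuclideanSpace ℝ (Fin d))) (C : ℝ)
    (φ ψ : EuclideanSpace ℝ (Fin d) → ℝ) (B : ℕ → ℝ)
    (k : ℕ → EuclideanSpace ℝ (Fin d) × 𝒲 → EuclideanSpace ℝ (Fin d)) (Pr : Measure Ω)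
    (W : Fin m × ℕ → Ω → 𝒲) (g : Fin m → ℕ → Ω → EuclideanSpace ℝ (Fin d))
    (x y z : ℕ → Ω → EuclideanSpace ℝ (Fin d)) : Prop where
  pos_m : 0 < m
  closed : IsClosed X
  convexOn : ConvexOn ℝ X φ
  prox : IsProxFunction X ψ
  pos : ∀ t, 0 < B t
  isOracle : ∀ t, IsOracle ν X C (k t)
  measurable_W : ∀ q, Measurable (W q)
  law : ∀ q, Pr.map (W q) = ν
  indep : iIndepFun W Pr
  x_init : ∃ x₀ ∈ X, ∀ ω, x 0 ω = x₀
  z_init : ∃ z₀ ∈ X, ∀ ω, z 0 ω = z₀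
  y_update : ∀ t ω, y t ω = (1 - theta t) • x t ω + theta t • z t ω
  x_update : ∀ t ω, x (t + 1) ω = (1 - theta t) • x t ω + theta t • z (t + 1) ω
  answer : ∀ i t p, Measurable[sampleSigma W {q | q.2 < t}] p → (∀ ω, p ω ∈ X) → p =ᵐ[Pr] y t →
    ∀ᵐ ω ∂Pr, g i t ω = k t (p ω, W (i, t) ω)
  minimizer : ∀ t, ∀ᵐ ω ∂Pr, z (t + 1) ω ∈ X ∧
    IsMinOn (stepObjective φ ψ (∑ τ ∈ Finset.range (t + 1), 1 / theta τ) (B (t + 1))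
      (∑ τ ∈ Finset.range (t + 1), (1 / theta τ) • (1 / (m : ℝ)) • ∑ i, g i τ ω)) X (z (t + 1) ω)

namespace IsOracleRun

variable {ν : Measure 𝒲} {X : Set (EuclideanSpace ℝ (Fin d))} {C : ℝ}
  {φ ψ : EuclideanSpace ℝ (Fin d) → ℝ} {B : ℕ → ℝ}
  {k : ℕ → EuclideanSpace ℝ (Fin d) × 𝒲 → EuclideanSpace ℝ (Fin d)} {Pr : Measure Ω}
  {W : Fin m × ℕ → Ω → 𝒲} {g : Fin m → ℕ → Ω → EuclideanSpace ℝ (Fin d)}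
  {x y z : ℕ → Ω → EuclideanSpace ℝ (Fin d)}

lemma nonempty (H : IsOracleRun ν X C φ ψ B k Pr W g x y z) : X.Nonempty :=
  H.x_init.imp fun _ h => h.1

lemma z_mem (H : IsOracleRun ν X C φ ψ B k Pr W g x y z) : ∀ᵐ ω ∂Pr, ∀ t, z t ω ∈ X := by
  refine ae_all_iff.2 fun t => ?_
  cases t with
  | zero =>
    obtain ⟨z₀, hz₀, h⟩ := H.z_init
    exact .of_forall fun ω => (h ω).symm ▸ hz₀
  | succ t => exact (H.minimizer t).mono fun ω h => h.1

lemma x_mem (H : IsOracleRun ν X C φ ψ B k Pr W g x y z) : ∀ᵐ ω ∂Pr, ∀ t, x t ω ∈ X := by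
  filter_upwards [H.z_mem] with ω hz t
  induction t with
  | zero =>
    obtain ⟨x₀, hx₀, h⟩ := H.x_init
    exact (h ω).symm ▸ hx₀
  | succ t ih =>
    rw [H.x_update]
    exact H.convexOn.1 ih (hz _) (sub_nonneg.2 (theta_le_one t)) (theta_pos t).le (by ring)

lemma y_mem (H : IsOracleRun ν X C φ ψ B k Pr W g x y z) : ∀ᵐ ω ∂Pr, ∀ t, y t ω ∈ X := by
  filter_upwards [H.z_mem, H.x_mem] with ω hz hx t
  rw [H.y_update]
  exact H.convexOn.1 (hx t) (hz t) (sub_nonneg.2 (theta_le_one t)) (theta_pos t).le (by ring)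

lemma y_adapted_of (H : IsOracleRun ν X C φ ψ B k Pr W g x y z) {t : ℕ}
    (hx : IsAdapted W Pr t (x t)) (hz : IsAdapted W Pr t (z t)) : IsAdapted W Pr t (y t) :=
  ((hx.const_smul _).add (hz.const_smul _)).congr (.of_forall fun ω => (H.y_update t ω).symm)

lemma exists_y_version (H : IsOracleRun ν X C φ ψ B k Pr W g x y z) {t : ℕ}
    (hy : IsAdapted W Pr t (y t)) :
    ∃ p : Ω → EuclideanSpace ℝ (Fin d), Measurable[sampleSigma W {q | q.2 < t}] p ∧
      (∀ ω, p ω ∈ X) ∧ p =ᵐ[Pr] y t :=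
  hy.exists_version H.closed.measurableSet H.nonempty (H.y_mem.mono fun _ h => h t)

variable [IsProbabilityMeasure ν] [IsProbabilityMeasure Pr]

lemma g_adapted_of (H : IsOracleRun ν X C φ ψ B k Pr W g x y z) {t : ℕ}
    (hy : IsAdapted W Pr t (y t)) (i : Fin m) :
    IsAdapted W Pr (t + 1) (g i t) ∧ ∫ ω, ‖g i t ω‖ ^ 2 ∂Pr ≤ C ^ 2 := by
  obtain ⟨p, hp, hpX, hpy⟩ := H.exists_y_version hy
  have hg := H.answer i t p hp hpX hpy
  have hW := H.measurable_W
  have hL := (H.isOracle t).memLp_comp (hp.mono (sampleSigma_le hW _) le_rfl) hpX (hW (i, t))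
    (H.law _) (indepFun_sample hW H.indep (notMem_past t i) hp)
  have hm : Measurable[sampleSigma W {q | q.2 < t + 1}] fun ω => k t (p ω, W (i, t) ω) :=
    (H.isOracle t).measurable.comp
      ((hp.mono (sampleSigma_mono W fun q hq => lt_trans hq (Nat.lt_succ_self t)) le_rfl).prodMk
        (measurable_sample W (S := {q | q.2 < t + 1}) (by simp)))
  refine ⟨IsAdapted.congr ⟨hm.stronglyMeasurable.aestronglyMeasurable, hL.1⟩
    (hg.mono fun ω h => h.symm), le_trans (le_of_eq ?_) hL.2⟩
  exact integral_congr_ae (hg.mono fun ω h => by simp only [h])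

/-- The iterates are adapted: the minimizer of each step is a Lipschitz function of the accumulated
subgradients. -/
lemma adapted (H : IsOracleRun ν X C φ ψ B k Pr W g x y z) (t : ℕ) :
    IsAdapted W Pr t (x t) ∧ IsAdapted W Pr t (z t) := by
  induction t using Nat.strong_induction_on with
  | _ t ih =>
    cases t with
    | zero =>
      obtain ⟨x₀, -, hx⟩ := H.x_init
      obtain ⟨z₀, -, hz⟩ := H.z_init
      exact ⟨(IsAdapted.const x₀).congr (.of_forall fun ω => (hx ω).symm),
        (IsAdapted.const z₀).congr (.of_forall fun ω => (hz ω).symm)⟩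
    | succ t =>
      obtain ⟨K, ζ, hζ, hmin⟩ := exists_lipschitz_minimizer H.convexOn H.prox
        (A := ∑ τ ∈ Finset.range (t + 1), 1 / theta τ)
        (Finset.sum_nonneg fun τ _ => (one_div_theta_pos τ).le) (H.pos (t + 1))
      have hS : IsAdapted W Pr (t + 1) fun ω =>
          ∑ τ ∈ Finset.range (t + 1), (1 / theta τ) • (1 / (m : ℝ)) • ∑ i, g i τ ω := by
        refine IsAdapted.sum _ fun τ hτ => ?_
        have hτ' := Finset.mem_range.1 hτ
        have hy := H.y_adapted_of (ih τ hτ').1 (ih τ hτ').2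
        exact ((IsAdapted.sum _ fun i _ => (H.g_adapted_of hy i).1.mono hτ').const_smul _).const_smul _
      have hz : IsAdapted W Pr (t + 1) (z (t + 1)) := (hS.comp_lipschitz hζ).congr
        ((H.minimizer t).mono fun ω h => (hmin _ _ h.1 h.2).symm)
      exact ⟨((((ih t (Nat.lt_succ_self t)).1.mono (Nat.le_succ t)).const_smul _).add
        (hz.const_smul _)).congr (.of_forall fun ω => (H.x_update t ω).symm), hz⟩

lemma y_adapted (H : IsOracleRun ν X C φ ψ B k Pr W g x y z) (t : ℕ) : IsAdapted W Pr t (y t) :=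
  H.y_adapted_of (H.adapted t).1 (H.adapted t).2

/-- The averaged answer at time `t` has second moment at most `C²`. -/
lemma integral_norm_sq_avg_le (H : IsOracleRun ν X C φ ψ B k Pr W g x y z) (t : ℕ) :
    Integrable (fun ω => ‖(1 / (m : ℝ)) • ∑ i, g i t ω‖ ^ 2) Pr ∧
      ∫ ω, ‖(1 / (m : ℝ)) • ∑ i, g i t ω‖ ^ 2 ∂Pr ≤ C ^ 2 := by
  have hg := fun i => H.g_adapted_of (H.y_adapted t) i
  have hI := integrable_norm_sq ((IsAdapted.sum Finset.univ fun i _ => (hg i).1).const_smul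
    (1 / (m : ℝ))).2
  have hm : (0 : ℝ) < m := by exact_mod_cast H.pos_m
  refine ⟨hI, ?_⟩
  calc ∫ ω, ‖(1 / (m : ℝ)) • ∑ i, g i t ω‖ ^ 2 ∂Pr
      ≤ ∫ ω, 1 / (m : ℝ) * ∑ i, ‖g i t ω‖ ^ 2 ∂Pr := by
        refine integral_mono hI ((integrable_finsetSum _ fun i _ =>
          integrable_norm_sq (hg i).1.2).const_mul _) fun ω => ?_
        have h1 : ‖∑ i, g i t ω‖ ^ 2 ≤ m * ∑ i, ‖g i t ω‖ ^ 2 := by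
          refine (pow_le_pow_left₀ (norm_nonneg _) (norm_sum_le _ _) 2).trans ?_
          simpa using sq_sum_le_card_mul_sum_sq (s := Finset.univ) (f := fun i => ‖g i t ω‖)
        simp only [norm_smul, mul_pow]
        rw [Real.norm_of_nonneg (by positivity)]
        calc (1 / (m : ℝ)) ^ 2 * ‖∑ i, g i t ω‖ ^ 2
            ≤ (1 / (m : ℝ)) ^ 2 * (m * ∑ i, ‖g i t ω‖ ^ 2) := by gcongr
          _ = _ := by field_simp
    _ = 1 / (m : ℝ) * ∑ i, ∫ ω, ‖g i t ω‖ ^ 2 ∂Pr := by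
        rw [integral_const_mul, integral_finsetSum _ fun i _ => integrable_norm_sq (hg i).1.2]
    _ ≤ 1 / (m : ℝ) * ∑ _i : Fin m, C ^ 2 := by gcongr with i; exact (hg i).2
    _ = C ^ 2 := by simp; field_simp

/-- The noise at time `t` is square integrable with variance at most `C² / m`, and uncorrelated with
the iterate `z t`. -/
lemma noise (H : IsOracleRun ν X C φ ψ B k Pr W g x y z) (t : ℕ)
    (xs : EuclideanSpace ℝ (Fin d)) {e : Ω → EuclideanSpace ℝ (Fin d)}
    (he : ∀ ω, e ω = oracleMean ν (k t) (y t ω) - (1 / (m : ℝ)) • ∑ i, g i t ω) :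
    MemLp e 2 Pr ∧ ∫ ω, ‖e ω‖ ^ 2 ∂Pr ≤ C ^ 2 / m ∧
      Integrable (fun ω => ⟪e ω, z t ω - xs⟫) Pr ∧ ∫ ω, ⟪e ω, z t ω - xs⟫ ∂Pr = 0 := by
  obtain ⟨p, hp, hpX, hpy⟩ := H.exists_y_version (H.y_adapted t)
  obtain ⟨q, hq, hqX, hqz⟩ := (H.adapted t).2.exists_version H.closed.measurableSet H.nonempty
    (H.z_mem.mono fun _ h => h t)
  have heq : batchNoise ν (k t) p (fun i => W (i, t)) =ᵐ[Pr] e := by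
    filter_upwards [hpy, ae_all_iff.2 fun i => H.answer i t p hp hpX hpy] with ω h1 h2
    rw [he, batchNoise, h1]
    simp only [h2, h1]
  have hj := notMem_past (m := m) t
  have hL := (H.isOracle t).memLp_batchNoise H.pos_m H.measurable_W H.law H.indep hj hp hpX
  have hLe := hL.ae_eq heq
  have hz2 : MemLp (fun ω => z t ω - xs) 2 Pr := (H.adapted t).2.2.sub (memLp_const xs)
  have hqe : (fun ω => z t ω - xs) =ᵐ[Pr] fun ω => q ω - xs := hqz.mono fun ω h => by simp only [h]
  refine ⟨hLe, ?_, integrable_inner_of_memLp_two hLe hz2, ?_⟩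
  · rw [← integral_congr_ae (heq.mono fun ω h => by
      simp only [h] : (fun ω => ‖batchNoise ν (k t) p (fun i => W (i, t)) ω‖ ^ 2)
        =ᵐ[Pr] fun ω => ‖e ω‖ ^ 2)]
    exact (H.isOracle t).integral_norm_sq_batchNoise_le H.pos_m H.measurable_W H.law H.indep hj
      (fun i i' h => (Prod.mk.inj h).1) hp hpX
  · rw [← (H.isOracle t).integral_inner_batchNoise H.pos_m H.measurable_W H.law H.indep hj hp hpX
      (b := fun ω => q ω - xs) (hq.sub measurable_const) (hz2.ae_eq hqe)]
    refine integral_congr_ae ?_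
    filter_upwards [heq, hqe] with ω h1 h2
    rw [h1, h2]

end IsOracleRun

end Iterates

/-! ### Growth and measurability of a closed convex function -/

section ClosedConvex

variable {d : ℕ} {X : Set (EuclideanSpace ℝ (Fin d))} {φ : EuclideanSpace ℝ (Fin d) → ℝ}

/-- A closed convex function decreases at most linearly: it is bounded below on a compact
neighbourhood of a point, and convexity propagates the bound along rays. -/
lemma exists_linear_lower_bound (hX : IsClosed X) (hφ : ConvexOn ℝ X φ)
    (hl : LowerSemicontinuousOn φ X) {x₀ : EuclideanSpace ℝ (Fin d)} (hx₀ : x₀ ∈ X) :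
    ∃ C : ℝ, 0 ≤ C ∧ ∀ v ∈ X, -(C * (1 + ‖v - x₀‖)) ≤ φ v := by
  have hK : IsCompact (X ∩ Metric.closedBall x₀ 1) := (isCompact_closedBall x₀ 1).inter_left hX
  have hne : (X ∩ Metric.closedBall x₀ 1).Nonempty :=
    ⟨x₀, hx₀, Metric.mem_closedBall_self zero_le_one⟩
  obtain ⟨a, ha, hmin⟩ := LowerSemicontinuousOn.exists_isMinOn hne hK (hl.mono Set.inter_subset_left)
  refine ⟨|φ a| + |φ x₀|, by positivity, fun v hv => ?_⟩
  have h1 := neg_abs_le (φ a)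
  have h2 := le_abs_self (φ x₀)
  have h2' := abs_nonneg (φ x₀)
  have h1' := abs_nonneg (φ a)
  set ρ := ‖v - x₀‖ with hρ
  have hρ0 : 0 ≤ ρ := norm_nonneg _
  by_cases hc : ρ ≤ 1
  · have h3 := isMinOn_iff.1 hmin v ⟨hv, by rwa [Metric.mem_closedBall, dist_eq_norm]⟩
    nlinarith
  · have hρ1 : 1 < ρ := not_le.1 hc
    have hi0 : 0 ≤ ρ⁻¹ := by positivity
    have hi1 : ρ⁻¹ ≤ 1 := inv_le_one_of_one_le₀ hρ1.le
    have h3 := hφ.2 hx₀ hv (sub_nonneg.2 hi1) hi0 (by ring)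
    have h4 := isMinOn_iff.1 hmin _ ⟨hφ.1 hx₀ hv (sub_nonneg.2 hi1) hi0 (by ring), by
      rw [Metric.mem_closedBall, dist_eq_norm,
        show (1 - ρ⁻¹) • x₀ + ρ⁻¹ • v - x₀ = ρ⁻¹ • (v - x₀) by module, norm_smul, norm_inv,
        Real.norm_of_nonneg hρ0, ← hρ, inv_mul_cancel₀ (by linarith)]⟩
    simp only [smul_eq_mul] at h3
    have h5 := mul_le_mul_of_nonneg_left (h4.trans h3) hρ0
    have e : ρ * ((1 - ρ⁻¹) * φ x₀ + ρ⁻¹ * φ v) = (ρ - 1) * φ x₀ + φ v := by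
      field_simp
    rw [e] at h5
    nlinarith [mul_le_mul_of_nonneg_left h1 hρ0,
      mul_le_mul_of_nonneg_left h2 (sub_nonneg.2 hρ1.le)]

lemma exists_measurable_eqOn (hX : IsClosed X) (hl : LowerSemicontinuousOn φ X)
    (hne : X.Nonempty) : ∃ φ' : EuclideanSpace ℝ (Fin d) → ℝ, Measurable φ' ∧
      ∀ v ∈ X, φ' v = φ v := by
  classical
  obtain ⟨x₀, hx₀⟩ := hne
  have h1 : Measurable (X.domRestrict φ) :=
    ((lowerSemicontinuous_restrict_iff).2 hl).measurable
  set r : EuclideanSpace ℝ (Fin d) → X := fun v => ⟨if v ∈ X then v else x₀, by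
    split_ifs with h
    · exact h
    · exact hx₀⟩ with hr
  have hrm : Measurable r :=
    (Measurable.ite hX.measurableSet measurable_id measurable_const).subtype_mk
  refine ⟨fun v => X.domRestrict φ (r v), h1.comp hrm, fun v hv => ?_⟩
  simp [hr, hv, Set.domRestrict]

end ClosedConvex

/-! ### The smoothed stochastic subgradient oracle -/

section Oracle

variable {d : ℕ} {Ξ : Type*} [MeasurableSpace Ξ] {P : Measure Ξ} [IsProbabilityMeasure P]
  {U : Set (EuclideanSpace ℝ (Fin d))} {L₀ : ℝ}
  {F : EuclideanSpace ℝ (Fin d) → Ξ → ℝ} {D : Ξ → Set (EuclideanSpace ℝ (Fin d))}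
  {Γ : EuclideanSpace ℝ (Fin d) × Ξ → EuclideanSpace ℝ (Fin d)}
  {M : Set (EuclideanSpace ℝ (Fin d) × Ξ)}

/-- The moment assumption bounds the gradient field at almost every point. -/
lemma ae_lintegral_gradient_le (hU : IsOpen U) (hM : MeasurableSet M)
    (hΓ : ∀ v s, (v, s) ∈ M → Γ (v, s) ∈ subdifferential (D s) (fun w => F w s) v)
    (hMae : ∀ᵐ s ∂P, ∀ᵐ v ∂volume.restrict U, (v, s) ∈ M)
    (hmoment : ∀ v ∈ U, ∫⁻ s, subdifferentialNorm (D s) (fun w => F w s) v ^ 2 ∂P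
      ≤ ENNReal.ofReal (L₀ ^ 2)) :
    ∀ᵐ v ∂volume.restrict U, (∀ᵐ s ∂P, (v, s) ∈ M) ∧
      ∫⁻ s, ‖Γ (v, s)‖ₑ ^ 2 ∂P ≤ ENNReal.ofReal (L₀ ^ 2) := by
  have h1 := (Measure.ae_ae_comm (μ := volume.restrict U) (ν := P)
    (p := fun v s => (v, s) ∈ M) hM).2 hMae
  filter_upwards [h1, ae_restrict_mem hU.measurableSet] with v hv hvU
  refine ⟨hv, le_trans (lintegral_mono_ae ?_) (hmoment v hvU)⟩
  filter_upwards [hv] with s hs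
  gcongr
  exact le_iSup₂ (f := fun g (_ : g ∈ subdifferential (D s) (fun w => F w s) v) => ‖g‖ₑ)
    (Γ (v, s)) (hΓ v s hs)

lemma hasBoundedSubgradients_objective (hU : IsOpen U) (hUc : Convex ℝ U) (hL₀ : 0 < L₀)
    (hD : ∀ᵐ s ∂P, U ⊆ D s) (hF : ∀ᵐ s ∂P, ConvexOn ℝ (D s) fun v => F v s)
    (hint : ∀ v ∈ U, Integrable (F v) P) (hΓm : Measurable Γ)
    (hΓ : ∀ v s, (v, s) ∈ M → Γ (v, s) ∈ subdifferential (D s) (fun w => F w s) v)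
    (hΓ2 : ∀ᵐ v ∂volume.restrict U, (∀ᵐ s ∂P, (v, s) ∈ M) ∧
      ∫⁻ s, ‖Γ (v, s)‖ₑ ^ 2 ∂P ≤ ENNReal.ofReal (L₀ ^ 2)) :
    HasBoundedSubgradients U L₀ (objective P F) fun v => ∫ s, Γ (v, s) ∂P := by
  have hsec : ∀ v, Measurable fun s => Γ (v, s) := fun v => hΓm.comp measurable_prodMk_left
  refine ⟨hU, ⟨hUc, fun v hv w hw a b ha hb hab => ?_⟩, hL₀.le,
    (hΓm.stronglyMeasurable.integral_prod_right').measurable, ?_, ?_⟩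
  · have h := integral_mono_ae (hint _ (hUc hv hw ha hb hab))
      (((hint v hv).const_mul a).add ((hint w hw).const_mul b)) (by
        filter_upwards [hD, hF] with s h1 h2
        exact h2.2 (h1 hv) (h1 hw) ha hb hab)
    rw [integral_add' ((hint v hv).const_mul a) ((hint w hw).const_mul b), integral_const_mul,
      integral_const_mul] at h
    exact h
  · filter_upwards [hΓ2] with v hv
    have h2 := memLp_two_of_lintegral_le (hsec v).aestronglyMeasurable hv.2
    have hi := integrable_norm_sq h2.1
    calc ‖∫ s, Γ (v, s) ∂P‖ ≤ ∫ s, ‖Γ (v, s)‖ ∂P := norm_integral_le_integral_norm _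
      _ ≤ ∫ s, (2 * L₀)⁻¹ * (‖Γ (v, s)‖ ^ 2 + L₀ ^ 2) ∂P := by
          refine integral_mono (h2.1.integrable one_le_two).norm
            ((hi.add (integrable_const _)).const_mul _) fun s => ?_
          simp only
          rw [inv_mul_eq_div, le_div_iff₀ (by positivity)]
          nlinarith [sq_nonneg (‖Γ (v, s)‖ - L₀)]
      _ = (2 * L₀)⁻¹ * (∫ s, ‖Γ (v, s)‖ ^ 2 ∂P + L₀ ^ 2) := by
          rw [integral_const_mul, integral_add hi (integrable_const _)]
          simp
      _ ≤ (2 * L₀)⁻¹ * (L₀ ^ 2 + L₀ ^ 2) := by gcongr; exact h2.2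
      _ = L₀ := by field_simp; ring
  · filter_upwards [hΓ2, ae_restrict_mem hU.measurableSet] with v hv hvU w hw
    have h2 := memLp_two_of_lintegral_le (hsec v).aestronglyMeasurable hv.2
    have hi := h2.1.integrable one_le_two
    have h := integral_mono_ae ((hint v hvU).add (hi.const_inner (w - v))) (hint w hw) (by
      filter_upwards [hv.1, hD] with s h1 h3
      have := (hΓ v s h1).2 w (h3 hw)
      rw [real_inner_comm] at this
      exact this)
    rw [integral_add' (hint v hvU) (hi.const_inner (w - v)), integral_inner hi,
      real_inner_comm] at h
    exact h

/-- The answer to the query at `y` with perturbation `w.1` and sample `w.2`. -/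
def perturbedOracle (Γ : EuclideanSpace ℝ (Fin d) × Ξ → EuclideanSpace ℝ (Fin d)) (r : ℝ)
    (x : EuclideanSpace ℝ (Fin d) × (EuclideanSpace ℝ (Fin d) × Ξ)) : EuclideanSpace ℝ (Fin d) :=
  Γ (x.1 + r • x.2.1, x.2.2)

variable {X : Set (EuclideanSpace ℝ (Fin d))} {r : ℝ}

lemma isOracle_perturbedOracle (hU : IsOpen U) (hr : 0 < r)
    (hX : ∀ y ∈ X, Metric.ball y r ⊆ U) (hΓm : Measurable Γ)
    (hΓ2 : ∀ᵐ v ∂volume.restrict U, (∀ᵐ s ∂P, (v, s) ∈ M) ∧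
      ∫⁻ s, ‖Γ (v, s)‖ₑ ^ 2 ∂P ≤ ENNReal.ofReal (L₀ ^ 2)) :
    IsOracle ((unifBall d).prod P) X L₀ (perturbedOracle Γ r) := by
  have hm : Measurable (perturbedOracle Γ r) := hΓm.comp (by fun_prop)
  refine ⟨hm, fun y hy => ?_⟩
  rw [lintegral_prod (fun w => ‖perturbedOracle Γ r (y, w)‖ₑ ^ 2)
    ((hm.comp measurable_prodMk_left).enorm.pow_const 2).aemeasurable]
  refine (lintegral_mono_ae ((ae_unifBall_of_ae_restrict hr hU (hX y hy) hΓ2).mono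
    fun z hz => hz.2.2)).trans ?_
  simp

lemma oracleMean_perturbedOracle
    (O : IsOracle ((unifBall d).prod P) X L₀ (perturbedOracle Γ r))
    {y : EuclideanSpace ℝ (Fin d)} (hy : y ∈ X) :
    oracleMean ((unifBall d).prod P) (perturbedOracle Γ r) y
      = smoothedGrad (fun v => ∫ s, Γ (v, s) ∂P) r y := by
  rw [oracleMean, integral_prod _ (O.integrable hy)]
  rfl

lemma ae_mem_perturbed (hU : IsOpen U) (hM : MeasurableSet M) (hr : 0 < r)
    {y : EuclideanSpace ℝ (Fin d)} (hy : Metric.ball y r ⊆ U)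
    (hΓ2 : ∀ᵐ v ∂volume.restrict U, (∀ᵐ s ∂P, (v, s) ∈ M) ∧
      ∫⁻ s, ‖Γ (v, s)‖ₑ ^ 2 ∂P ≤ ENNReal.ofReal (L₀ ^ 2)) :
    ∀ᵐ w ∂(unifBall d).prod P, (y + r • w.1, w.2) ∈ M := by
  have hm : MeasurableSet
      ((fun w : EuclideanSpace ℝ (Fin d) × Ξ => (y + r • w.1, w.2)) ⁻¹' M) :=
    (show Measurable fun w : EuclideanSpace ℝ (Fin d) × Ξ => (y + r • w.1, w.2) by fun_prop) hM
  exact (Measure.ae_prod_mem_iff_ae_ae_mem hm).2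
    ((ae_unifBall_of_ae_restrict hr hU hy hΓ2).mono fun z hz => hz.2.1)

end Oracle

/-! ### The rate -/

/-- The expected right-hand side of the sample path bound is of the required order. -/
lemma rate_bound {d m : ℕ} (hd : 0 < d) (hm : 0 < m) {L₀ R u : ℝ} (hL₀ : 0 < L₀) (hR : 0 < R)
    (hu : u = R * (d : ℝ) ^ (1 / 4 : ℝ)) {uₜ L η : ℕ → ℝ} (huₜ : ∀ t, uₜ t = theta t * u)
    (hη : ∀ t, η t = L₀ * √((t : ℝ) + 1) / (R * √(m : ℝ)))
    (hL : ∀ t, L t = L₀ * √(d : ℝ) / uₜ t) {n : ℕ} (hn : 3 ≤ n) :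
    (L (n + 1) + η (n + 1) / theta (n + 1)) * R ^ 2 + ((n : ℝ) + 1) * (L₀ * u) + 5 * L₀ * R
      + ∑ t ∈ Finset.range n, 1 / theta (t + 1) * (L₀ ^ 2 / m / (2 * η (t + 1))) ≤
    (1 / theta n) ^ 2 * (10 * L₀ * R * (d : ℝ) ^ (1 / 4 : ℝ) / ((n + 1 : ℕ) : ℝ)
      + 5 * L₀ * R / √(((n + 1 : ℕ) : ℝ) * m)) := by
  set q : ℝ := (d : ℝ) ^ (1 / 4 : ℝ) with hq
  have hd1 : (1 : ℝ) ≤ d := by exact_mod_cast hd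
  have hq1 : 1 ≤ q := Real.one_le_rpow hd1 (by norm_num)
  have hq0 : 0 < q := by linarith
  have hq2 : √(d : ℝ) = q ^ 2 := by
    rw [hq, Real.sqrt_eq_rpow, ← Real.rpow_natCast, ← Real.rpow_mul (by positivity)]
    norm_num
  set s : ℝ := √(m : ℝ) with hs
  have hm0 : (0 : ℝ) < m := by exact_mod_cast hm
  have hs0 : 0 < s := Real.sqrt_pos.2 hm0
  have hs2 : (m : ℝ) = s ^ 2 := (Real.sq_sqrt hm0.le).symm
  set N : ℝ := ((n + 1 : ℕ) : ℝ) with hN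
  have hNn : (n : ℝ) + 1 = N := by rw [hN]; push_cast; ring
  have hN4 : 4 ≤ N := by
    have : (3 : ℝ) ≤ n := by exact_mod_cast hn
    linarith
  have hN0 : 0 < N := by linarith
  set w : ℝ := √N with hw
  have hw0 : 0 < w := Real.sqrt_pos.2 hN0
  have hw2 : N = w ^ 2 := (Real.sq_sqrt hN0.le).symm
  set a := 1 / theta n with ha
  set b := 1 / theta (n + 1) with hb
  have haN : (N + 1) / 2 ≤ a := by have := le_inv_theta n; rw [← hNn]; linarith
  have hb0 : 0 < b := one_div_theta_pos _
  have hbN : N / 2 + 1 ≤ b := by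
    have := le_inv_theta (n + 1); rw [← hN] at this; linarith
  have hab : b ^ 2 - b = a ^ 2 := inv_theta_succ_sq n
  have haN2 : N ^ 2 + 2 * N + 1 ≤ 4 * a ^ 2 := by
    have := pow_le_pow_left₀ (by positivity) haN 2
    linarith
  have hNN : 4 * N ≤ N ^ 2 := by rw [sq]; gcongr
  have hbA : b ≤ 2 * a ^ 2 / N := by
    rw [le_div_iff₀ hN0, ← hab]
    have := mul_le_mul_of_nonneg_left hbN hb0.le
    linarith
  have hsqrt : √(N * m) = w * s := Real.sqrt_mul hN0.le _
  have hη0 : ∀ t, 0 < η t := fun t => by rw [hη]; positivity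
  -- the smoothness part of the damping
  have e1 : L (n + 1) * R ^ 2 = L₀ * R * q * b := by
    rw [hL, huₜ, hu, hq2, hb]
    have := (theta_pos (n + 1)).ne'
    field_simp
  have i1 : L (n + 1) * R ^ 2 ≤ 2 * (L₀ * R * q * a ^ 2 / N) := by
    rw [e1]
    calc L₀ * R * q * b ≤ L₀ * R * q * (2 * a ^ 2 / N) := by gcongr
      _ = _ := by ring
  -- the bias of the smoothing
  have i2 : N * (L₀ * u) ≤ 4 * (L₀ * R * q * a ^ 2 / N) := by
    have : N ≤ 4 * (a ^ 2 / N) := by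
      rw [← mul_div_assoc, le_div_iff₀ hN0]; linarith
    calc N * (L₀ * u) = L₀ * R * q * N := by rw [hu]; ring
      _ ≤ L₀ * R * q * (4 * (a ^ 2 / N)) := by gcongr
      _ = _ := by ring
  -- the first step
  have i3 : 5 * L₀ * R ≤ 4 * (L₀ * R * q * a ^ 2 / N) := by
    have : 5 ≤ 4 * (a ^ 2 / N) := by
      rw [← mul_div_assoc, le_div_iff₀ hN0]; linarith
    have h5 : 5 ≤ q * (4 * (a ^ 2 / N)) :=
      this.trans (le_mul_of_one_le_left (by positivity) hq1)
    calc 5 * L₀ * R = L₀ * R * 5 := by ring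
      _ ≤ L₀ * R * (q * (4 * (a ^ 2 / N))) := by gcongr
      _ = _ := by ring
  -- the stochastic part of the damping
  have i4 : η (n + 1) / theta (n + 1) * R ^ 2 ≤ 5 / 2 * (L₀ * R * a ^ 2 / (w * s)) := by
    have h1 : √(((n + 1 : ℕ) : ℝ) + 1) ≤ 5 / 4 * w := by
      rw [← hN]
      refine Real.sqrt_le_iff.2 ⟨by positivity, ?_⟩
      rw [mul_pow, ← hw2]
      linarith
    calc η (n + 1) / theta (n + 1) * R ^ 2
        = L₀ * R / s * (√(((n + 1 : ℕ) : ℝ) + 1) * b) := by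
          rw [hη, hb]; field_simp
      _ ≤ L₀ * R / s * (5 / 4 * w * (2 * a ^ 2 / N)) := by gcongr
      _ = _ := by rw [hw2]; field_simp; ring
  -- the noise
  have i5 : ∑ t ∈ Finset.range n, 1 / theta (t + 1) * (L₀ ^ 2 / m / (2 * η (t + 1)))
      ≤ 2 * (L₀ * R * a ^ 2 / (w * s)) := by
    have hterm : ∀ t ∈ Finset.range n, 1 / theta (t + 1) * (L₀ ^ 2 / m / (2 * η (t + 1)))
        ≤ L₀ * R / (2 * s) * w := by
      intro t ht
      set c : ℝ := √(((t + 1 : ℕ) : ℝ) + 1) with hc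
      have hc0 : 0 < c := Real.sqrt_pos.2 (by positivity)
      have hc2 : ((t + 1 : ℕ) : ℝ) + 1 = c ^ 2 := (Real.sq_sqrt (by positivity)).symm
      have hcw : c ≤ w := by
        refine Real.sqrt_le_sqrt ?_
        rw [hN]
        exact_mod_cast Nat.succ_le_succ (Finset.mem_range.1 ht)
      have h1 : 1 / theta (t + 1) ≤ c ^ 2 := by rw [← hc2]; exact inv_theta_le _
      calc 1 / theta (t + 1) * (L₀ ^ 2 / m / (2 * η (t + 1)))
          ≤ c ^ 2 * (L₀ ^ 2 / m / (2 * η (t + 1))) := by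
            have := hη0 (t + 1)
            gcongr
        _ = L₀ * R / (2 * s) * c := by rw [hη, ← hc, hs2]; field_simp
        _ ≤ _ := by gcongr
    refine (Finset.sum_le_sum hterm).trans ?_
    rw [Finset.sum_const, Finset.card_range, nsmul_eq_mul]
    have hnN : (n : ℝ) ≤ N := by linarith
    have h4 : N ^ 2 ≤ 4 * a ^ 2 := by linarith
    calc (n : ℝ) * (L₀ * R / (2 * s) * w) ≤ N * (L₀ * R / (2 * s) * w) := by gcongr
      _ = L₀ * R / (2 * (w * s)) * N ^ 2 := by rw [hw2]; field_simp
      _ ≤ L₀ * R / (2 * (w * s)) * (4 * a ^ 2) := by gcongr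
      _ = _ := by field_simp; ring
  have hpos : 0 ≤ L₀ * R * a ^ 2 / (w * s) := by positivity
  have e : a ^ 2 * (10 * L₀ * R * q / N + 5 * L₀ * R / (w * s))
      = 10 * (L₀ * R * q * a ^ 2 / N) + 5 * (L₀ * R * a ^ 2 / (w * s)) := by ring
  rw [hsqrt, e, add_mul, hNn]
  linarith

/-! ### The convergence rate -/

section Convergence

variable {d m : ℕ} {Ξ Ω : Type*} [MeasurableSpace Ξ] [MeasurableSpace Ω]
  {P : Measure Ξ} {Pr : Measure Ω}
  {X U : Set (EuclideanSpace ℝ (Fin d))} {L₀ R u : ℝ}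
  {F : EuclideanSpace ℝ (Fin d) → Ξ → ℝ} {D : Ξ → Set (EuclideanSpace ℝ (Fin d))}
  {φ ψ : EuclideanSpace ℝ (Fin d) → ℝ} {uₜ L η : ℕ → ℝ}
  {Z : Fin m → ℕ → Ω → EuclideanSpace ℝ (Fin d)} {ξ : Fin m → ℕ → Ω → Ξ}
  {g : Fin m → ℕ → Ω → EuclideanSpace ℝ (Fin d)}
  {x y z : ℕ → Ω → EuclideanSpace ℝ (Fin d)}
  {Γ : EuclideanSpace ℝ (Fin d) × Ξ → EuclideanSpace ℝ (Fin d)}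
  {M : Set (EuclideanSpace ℝ (Fin d) × Ξ)}

/-- A run of randomized smoothing is a run with abstract oracles: off a null set the perturbed query
point is one where the subgradient is unique, so the answer is a function of the query point, the
perturbation and the sample, whatever rule selects the subgradient. -/
lemma IsRun.isOracleRun [IsProbabilityMeasure P] [IsProbabilityMeasure Pr]
    (hrun : IsRun X P F D φ ψ (unifBall d) uₜ L η Pr Z ξ g x y z) (hm : 0 < m)
    (hX : IsClosed X) (hφ : ConvexOn ℝ X φ) (hψ : IsProxFunction X ψ)
    (hB : ∀ t, 0 < L t + η t / theta t) (hut : ∀ t, 0 < uₜ t) (hU : IsOpen U)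
    (hball : ∀ t, ∀ y ∈ X, Metric.ball y (uₜ t) ⊆ U) (hM : MeasurableSet M)
    (hΓ : ∀ v s, (v, s) ∈ M → ∀ g ∈ subdifferential (D s) (fun w => F w s) v, g = Γ (v, s))
    (hO : ∀ t, IsOracle ((unifBall d).prod P) X L₀ (perturbedOracle Γ (uₜ t)))
    (hΓ2 : ∀ᵐ v ∂volume.restrict U, (∀ᵐ s ∂P, (v, s) ∈ M) ∧
      ∫⁻ s, ‖Γ (v, s)‖ₑ ^ 2 ∂P ≤ ENNReal.ofReal (L₀ ^ 2)) :
    IsOracleRun ((unifBall d).prod P) X L₀ φ ψ (fun t => L t + η t / theta t)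
      (fun t => perturbedOracle Γ (uₜ t)) Pr (fun q ω => (Z q.1 q.2 ω, ξ q.1 q.2 ω)) g x y z where
  pos_m := hm
  closed := hX
  convexOn := hφ
  prox := hψ
  pos := hB
  isOracle := hO
  measurable_W q := (hrun.measurable_Z _ _).prodMk (hrun.measurable_ξ _ _)
  law q := hrun.law _ _
  indep := hrun.indep
  x_init := hrun.x_init
  z_init := hrun.z_init
  y_update := hrun.y_update
  x_update := hrun.x_update
  answer i t p hp hpX hpy := by
    have hW : ∀ q : Fin m × ℕ, Measurable fun ω => (Z q.1 q.2 ω, ξ q.1 q.2 ω) := fun q =>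
      (hrun.measurable_Z _ _).prodMk (hrun.measurable_ξ _ _)
    have hN : MeasurableSet ((fun q : EuclideanSpace ℝ (Fin d) × (EuclideanSpace ℝ (Fin d) × Ξ) =>
        (q.1 + uₜ t • q.2.1, q.2.2)) ⁻¹' M) :=
      (show Measurable fun q : EuclideanSpace ℝ (Fin d) × (EuclideanSpace ℝ (Fin d) × Ξ) =>
        (q.1 + uₜ t • q.2.1, q.2.2) by fun_prop) hM
    have h := ae_comp_indep (hp.mono (sampleSigma_le hW _) le_rfl) (hW (i, t)) (hrun.law i t)
      (indepFun_sample hW hrun.indep (notMem_past t i) hp) hN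
      fun ω => ae_mem_perturbed hU hM (hut t) (hball t _ (hpX ω)) hΓ2
    filter_upwards [h, hpy, hrun.oracle i t] with ω h1 h2 h3
    rw [← h2] at h3
    exact hΓ _ _ h1 _ h3
  minimizer t := by
    filter_upwards [hrun.z_update t] with ω hω
    refine ⟨hω.1, ?_⟩
    convert hω.2 using 2 with v
    rw [stepObjective, sum_inner, Finset.sum_mul]
    simp only [real_inner_smul_left]
    ring

/-- The error bound along a sample path whose iterates stay in `X`, with the smoothing bias and the
first step estimated. -/
lemma IsRun.sample_path_bound
    (hrun : IsRun X P F D φ ψ (unifBall d) uₜ L η Pr Z ξ g x y z) (hd : 0 < d) (hm : 0 < m)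
    (hL₀ : 0 < L₀) (hR : 0 < R) (hu : u = R * (d : ℝ) ^ (1 / 4 : ℝ)) (hφ : ConvexOn ℝ X φ)
    (hψ : IsProxFunction X ψ) (huₜ : ∀ t, uₜ t = theta t * u)
    (hη : ∀ t, η t = L₀ * √((t : ℝ) + 1) / (R * √(m : ℝ)))
    (hL : ∀ t, L t = L₀ * √(d : ℝ) / uₜ t)
    {f : EuclideanSpace ℝ (Fin d) → ℝ} {γ : EuclideanSpace ℝ (Fin d) → EuclideanSpace ℝ (Fin d)}
    (HB : HasBoundedSubgradients U L₀ f γ)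
    (hball : ∀ t, ∀ y ∈ X, Metric.ball y (uₜ t) ⊆ U)
    {G : ℕ → Ω → EuclideanSpace ℝ (Fin d)}
    (hG : ∀ t ω, y t ω ∈ X → G t ω = smoothedGrad γ (uₜ t) (y t ω))
    {xs : EuclideanSpace ℝ (Fin d)} (hxs : xs ∈ X) (hψxs : ψ xs ≤ R ^ 2)
    {ω : Ω} (hx : ∀ t, x t ω ∈ X) (hz : ∀ t, z t ω ∈ X) (hy : ∀ t, y t ω ∈ X)
    (hmin : ∀ t, IsMinOn (stepObjective φ ψ (∑ τ ∈ Finset.range (t + 1), 1 / theta τ)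
      (L (t + 1) + η (t + 1) / theta (t + 1))
      (∑ τ ∈ Finset.range (t + 1), (1 / theta τ) • (1 / (m : ℝ)) • ∑ i, g i τ ω)) X
        (z (t + 1) ω)) (n : ℕ) :
    (1 / theta n) ^ 2 * (f (x (n + 1) ω) + φ (x (n + 1) ω)) ≤
      (1 / theta n) ^ 2 * (f xs + φ xs)
      + ((L (n + 1) + η (n + 1) / theta (n + 1)) * R ^ 2 + ((n : ℝ) + 1) * (L₀ * u)
        + 3 * L₀ * R + 2 * (R / L₀) * ‖(1 / (m : ℝ)) • ∑ i, g i 0 ω‖ ^ 2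
        + ∑ t ∈ Finset.range n, 1 / theta (t + 1) *
          (⟪G (t + 1) ω - (1 / (m : ℝ)) • ∑ i, g i (t + 1) ω, z (t + 1) ω - xs⟫
          + ‖G (t + 1) ω - (1 / (m : ℝ)) • ∑ i, g i (t + 1) ω‖ ^ 2 / (2 * η (t + 1)))) := by
  have hd0 : (0 : ℝ) < d := by exact_mod_cast hd
  have hm0 : (0 : ℝ) < m := by exact_mod_cast hm
  have hu0 : 0 < u := by rw [hu]; positivity
  have hut : ∀ t, 0 < uₜ t := fun t => by rw [huₜ]; exact mul_pos (theta_pos t) hu0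
  have hLp : ∀ t, 0 ≤ L t := fun t => by rw [hL]; have := hut t; positivity
  have hηp : ∀ t, 0 < η t := fun t => by rw [hη]; positivity
  have hmono : ∀ t, L t + η t / theta t ≤ L (t + 1) + η (t + 1) / theta (t + 1) := fun t => by
    have h1 := theta_succ_le t
    have h2 := theta_pos (t + 1)
    have h3 : uₜ (t + 1) ≤ uₜ t := by rw [huₜ, huₜ]; gcongr
    have h4 : η t ≤ η (t + 1) := by rw [hη, hη]; push_cast; gcongr; linarith
    have h5 := hut (t + 1)
    have h6 := (hηp (t + 1)).le
    have h7 : L t ≤ L (t + 1) := by rw [hL, hL]; gcongr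
    have h8 : η t / theta t ≤ η (t + 1) / theta (t + 1) := by gcongr
    linarith
  have hpath := path_bound hφ hψ (f := fun t => smoothed f (uₜ t)) (G := fun t => G t ω)
    (g := fun t => (1 / (m : ℝ)) • ∑ i, g i t ω) hxs hLp hηp hmono hx hz
    (fun t => hrun.y_update t ω) (fun t => hrun.x_update t ω) hmin
    (fun t w hw => by
      rw [hG t ω (hy t), hL]
      exact HB.smoothed_descent hd (hut t) (hball t _ (hy t)) (hball t w hw))
    (fun t w hw => by
      rw [hG t ω (hy t)]
      exact HB.smoothed_subgradient (hut t) (hball t _ (hy t)) (hball t w hw))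
    (fun t w hw => HB.smoothed_mono (hut (t + 1))
      (by rw [huₜ, huₜ]; exact mul_le_mul_of_nonneg_right (theta_succ_le t) hu0.le)
      (hball t w hw)) n
  have hsm : ∀ t, 1 / theta t * smoothed f (uₜ t) xs ≤ 1 / theta t * f xs + L₀ * u := fun t => by
    have h1 := HB.smoothed_le (hut t) (hball t xs hxs)
    have h2 := mul_le_mul_of_nonneg_left h1 (one_div_theta_pos t).le
    refine h2.trans (le_of_eq ?_)
    rw [huₜ]
    have := (theta_pos t).ne'
    field_simp
  have hfirst := first_step_le hφ.1 hψ (hz 1) hxs (g := (1 / (m : ℝ)) • ∑ i, g i 0 ω)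
    (B := L 1 + η 1 / theta 1) (a := smoothed f (uₜ 0) (z 1 ω)) (b := smoothed f (uₜ 0) xs)
    hL₀ hR hψxs ?_ ?_
  · have hTn : f (x (n + 1) ω) ≤ smoothed f (uₜ n) (x (n + 1) ω) :=
      HB.le_smoothed (hut n) (hball n _ (hx _))
    have h1 := mul_le_mul_of_nonneg_left hTn (sq_nonneg (1 / theta n))
    have h2 : (L (n + 1) + η (n + 1) / theta (n + 1)) * ψ xs
        ≤ (L (n + 1) + η (n + 1) / theta (n + 1)) * R ^ 2 := by
      have := hLp (n + 1)
      have := (hηp (n + 1)).le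
      have := theta_pos (n + 1)
      gcongr
    have h3 : ∑ t ∈ Finset.range n, 1 / theta (t + 1) * (smoothed f (uₜ (t + 1)) xs
          + ⟪G (t + 1) ω - (1 / (m : ℝ)) • ∑ i, g i (t + 1) ω, z (t + 1) ω - xs⟫
          + ‖G (t + 1) ω - (1 / (m : ℝ)) • ∑ i, g i (t + 1) ω‖ ^ 2 / (2 * η (t + 1)))
        ≤ ∑ t ∈ Finset.range n, 1 / theta (t + 1) * f xs + n * (L₀ * u)
          + ∑ t ∈ Finset.range n, 1 / theta (t + 1) *
          (⟪G (t + 1) ω - (1 / (m : ℝ)) • ∑ i, g i (t + 1) ω, z (t + 1) ω - xs⟫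
          + ‖G (t + 1) ω - (1 / (m : ℝ)) • ∑ i, g i (t + 1) ω‖ ^ 2 / (2 * η (t + 1))) := by
      have : (n : ℝ) * (L₀ * u) = ∑ _t ∈ Finset.range n, L₀ * u := by simp
      rw [this, ← Finset.sum_add_distrib, ← Finset.sum_add_distrib]
      exact Finset.sum_le_sum fun t _ => by linarith [hsm (t + 1)]
    have h4 : (1 / theta n) ^ 2 * f xs = f xs + ∑ t ∈ Finset.range n, 1 / theta (t + 1) * f xs := by
      rw [← sum_inv_theta, Finset.sum_range_succ', add_mul, Finset.sum_mul]
      simp [theta]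
      ring
    have h5 := hsm 0
    simp only [theta, one_div_one, one_mul] at h5
    have h6 : (2 * L₀ ^ 2 + 2 * ‖(1 / (m : ℝ)) • ∑ i, g i 0 ω‖ ^ 2) * (R / L₀) + L₀ * R
        = 3 * L₀ * R + 2 * (R / L₀) * ‖(1 / (m : ℝ)) • ∑ i, g i 0 ω‖ ^ 2 := by
      field_simp
      ring
    linarith
  · -- `L₁ = (L₀ / R) d^{1/4} / θ₁ ≥ L₀ / R`
    have hq1 : (1 : ℝ) ≤ (d : ℝ) ^ (1 / 4 : ℝ) :=
      Real.one_le_rpow (by exact_mod_cast hd) (by norm_num)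
    have hq2 : √(d : ℝ) = ((d : ℝ) ^ (1 / 4 : ℝ)) ^ 2 := by
      rw [Real.sqrt_eq_rpow, ← Real.rpow_natCast, ← Real.rpow_mul (by positivity)]
      norm_num
    have h1 : L₀ / R ≤ L 1 := by
      rw [hL, hq2, div_le_div_iff₀ hR (hut 1), huₜ, hu]
      have h2 : theta 1 * (R * (d : ℝ) ^ (1 / 4 : ℝ)) ≤ 1 * (R * (d : ℝ) ^ (1 / 4 : ℝ)) := by
        have := theta_le_one 1
        gcongr
      have h3 : R * (d : ℝ) ^ (1 / 4 : ℝ) ≤ R * ((d : ℝ) ^ (1 / 4 : ℝ)) ^ 2 := by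
        rw [sq]
        exact mul_le_mul_of_nonneg_left (le_mul_of_one_le_left (by positivity) hq1) hR.le
      calc _ ≤ L₀ * (R * ((d : ℝ) ^ (1 / 4 : ℝ)) ^ 2) :=
            mul_le_mul_of_nonneg_left (by linarith) hL₀.le
        _ = _ := by ring
    have h2 := div_pos (hηp 1) (theta_pos 1)
    linarith
  · have h1 := HB.smoothed_subgradient (hut 0) (hball 0 _ (hz 1)) (hball 0 _ hxs)
    have h2 : ‖smoothedGrad γ (uₜ 0) (z 1 ω)‖ ≤ L₀ := HB.norm_smoothedGrad_le (hut 0)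
      (hball 0 _ (hz 1))
    have h3 := (abs_le.1 (abs_real_inner_le_norm (smoothedGrad γ (uₜ 0) (z 1 ω)) (xs - z 1 ω))).1
    have h4 : ‖smoothedGrad γ (uₜ 0) (z 1 ω)‖ * ‖xs - z 1 ω‖ ≤ L₀ * ‖z 1 ω - xs‖ := by
      rw [norm_sub_rev]; gcongr
    linarith

end Convergence

end RandSmooth

open RandSmooth in
theorem corollary1 {d m : ℕ} (hd : 0 < d) (hm : 0 < m)
    {Ξ Ω : Type*} [MeasurableSpace Ξ] [MeasurableSpace Ω]
    (P : Measure Ξ) [IsProbabilityMeasure P] (Pr : Measure Ω) [IsProbabilityMeasure Pr]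
    (X : Set (EuclideanSpace ℝ (Fin d))) (hXclosed : IsClosed X) (hXconvex : Convex ℝ X)
    (L₀ R u : ℝ) (hL₀ : 0 < L₀) (hR : 0 < R) (hu : u = R * (d : ℝ) ^ (1 / 4 : ℝ))
    (F : EuclideanSpace ℝ (Fin d) → Ξ → ℝ) (D : Ξ → Set (EuclideanSpace ℝ (Fin d)))
    (hdom : ∀ᵐ s ∂P, X + Metric.closedBall 0 u ⊆ D s)
    (hFconvex : ∀ᵐ s ∂P, ConvexOn ℝ (D s) (fun v => F v s))
    (hFint : ∀ v ∈ X + Metric.closedBall (0 : EuclideanSpace ℝ (Fin d)) u, Integrable (F v) P)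
    (hmoment : ∀ v ∈ X + Metric.closedBall (0 : EuclideanSpace ℝ (Fin d)) u,
      ∫⁻ s, RandSmooth.subdifferentialNorm (D s) (fun w => F w s) v ^ 2 ∂P
        ≤ ENNReal.ofReal (L₀ ^ 2))
    (φ : EuclideanSpace ℝ (Fin d) → ℝ) (hφconvex : ConvexOn ℝ X φ)
    (hφclosed : LowerSemicontinuousOn φ X)
    (ψ : EuclideanSpace ℝ (Fin d) → ℝ) (hψ : RandSmooth.IsProxFunction X ψ)
    (uₜ L η : ℕ → ℝ)
    (huₜ : ∀ t, uₜ t = RandSmooth.theta t * u)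
    (hη : ∀ t, η t = L₀ * √((t : ℝ) + 1) / (R * √(m : ℝ)))
    (hL : ∀ t, L t = L₀ * √(d : ℝ) / uₜ t)
    (Z : Fin m → ℕ → Ω → EuclideanSpace ℝ (Fin d)) (ξ : Fin m → ℕ → Ω → Ξ)
    (g : Fin m → ℕ → Ω → EuclideanSpace ℝ (Fin d))
    (x y z : ℕ → Ω → EuclideanSpace ℝ (Fin d))
    (hrun : RandSmooth.IsRun X P F D φ ψ (RandSmooth.unifBall d) uₜ L η Pr Z ξ g x y z)
    (xs : EuclideanSpace ℝ (Fin d)) (hxs : xs ∈ X) (hψxs : ψ xs ≤ R ^ 2)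
    (T : ℕ) (hT : 4 ≤ T) :
    Integrable (fun ω => RandSmooth.objective P F (x T ω) + φ (x T ω)) Pr ∧
    (∫ ω, (RandSmooth.objective P F (x T ω) + φ (x T ω)) ∂Pr)
        - (RandSmooth.objective P F xs + φ xs)
      ≤ 10 * L₀ * R * (d : ℝ) ^ (1 / 4 : ℝ) / T + 5 * L₀ * R / √((T : ℝ) * m) := by
  obtain ⟨n, rfl⟩ : ∃ n, T = n + 1 := ⟨T - 1, by omega⟩
  have hn : 3 ≤ n := by omega
  have hd0 : (0 : ℝ) < d := by exact_mod_cast hd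
  have hm0 : (0 : ℝ) < m := by exact_mod_cast hm
  have hu0 : 0 < u := by rw [hu]; positivity
  have hut : ∀ t, 0 < uₜ t := fun t => by rw [huₜ]; exact mul_pos (theta_pos t) hu0
  have hutu : ∀ t, uₜ t ≤ u := fun t => by
    rw [huₜ]; exact mul_le_of_le_one_left hu0.le (theta_le_one t)
  have hηp : ∀ t, 0 < η t := fun t => by rw [hη]; positivity
  have hBp : ∀ t, 0 < L t + η t / theta t := fun t => by
    have h1 : 0 ≤ L t := by rw [hL]; have := hut t; positivity
    have h2 := div_pos (hηp t) (theta_pos t)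
    linarith
  -- The open neighbourhood of `X` on which all functions are finite.
  set U : Set (EuclideanSpace ℝ (Fin d)) := X + Metric.ball 0 u with hUdef
  have hU : IsOpen U := Metric.isOpen_ball.add_left
  have hUc : Convex ℝ U := hXconvex.add (convex_ball 0 u)
  have hUX : U ⊆ X + Metric.closedBall 0 u := Set.add_subset_add_left Metric.ball_subset_closedBall
  have hball : ∀ t, ∀ y ∈ X, Metric.ball y (uₜ t) ⊆ U := fun t y hy v hv =>
    Set.mem_add.2 ⟨y, hy, v - y, by
      rw [mem_ball_zero_iff, ← dist_eq_norm]
      exact (Metric.mem_ball.1 hv).trans_le (hutu t), by abel⟩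
  have hXU : X ⊆ U := fun y hy => hball 0 y hy (Metric.mem_ball_self (hut 0))
  have hD : ∀ᵐ s ∂P, U ⊆ D s := hdom.mono fun s hs => hUX.trans hs
  -- The gradient field and the smoothed oracles.
  obtain ⟨Γ, M, hΓm, hM, hΓ, hMae⟩ := exists_gradient_field P hU hUc ⟨xs, hXU hxs⟩ hD hFconvex
    fun v hv => (hFint v (hUX hv)).1
  have hΓ2 := ae_lintegral_gradient_le (L₀ := L₀) hU hM (fun v s h => (hΓ v s h).1) hMae
    fun v hv => hmoment v (hUX hv)
  have HB := hasBoundedSubgradients_objective hU hUc hL₀ hD hFconvex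
    (fun v hv => hFint v (hUX hv)) hΓm (fun v s h => (hΓ v s h).1) hΓ2
  have hO : ∀ t, IsOracle ((unifBall d).prod P) X L₀ (perturbedOracle Γ (uₜ t)) := fun t =>
    isOracle_perturbedOracle hU (hut t) (hball t) hΓm hΓ2
  have H := hrun.isOracleRun hm hXclosed hφconvex hψ hBp hut hU hball hM
    (fun v s h => (hΓ v s h).2) hO hΓ2
  set f := objective P F with hf
  set avg : ℕ → Ω → EuclideanSpace ℝ (Fin d) := fun t ω => (1 / (m : ℝ)) • ∑ i, g i t ω with havg
  set G : ℕ → Ω → EuclideanSpace ℝ (Fin d) := fun t ω =>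
    oracleMean ((unifBall d).prod P) (perturbedOracle Γ (uₜ t)) (y t ω) with hGdef
  have hnoise := fun t => H.noise t xs (e := fun ω => G t ω - avg t ω) fun ω => rfl
  have havg0 := H.integral_norm_sq_avg_le 0
  set A := (1 / theta n) ^ 2 with hA
  have hApos : 0 < A := pow_pos (one_div_theta_pos n) 2
  set K := (L (n + 1) + η (n + 1) / theta (n + 1)) * R ^ 2 + ((n : ℝ) + 1) * (L₀ * u)
    + 3 * L₀ * R with hK
  set S : Ω → ℝ := fun ω => K + 2 * (R / L₀) * ‖avg 0 ω‖ ^ 2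
    + ∑ t ∈ Finset.range n, 1 / theta (t + 1) * (⟪G (t + 1) ω - avg (t + 1) ω, z (t + 1) ω - xs⟫
      + ‖G (t + 1) ω - avg (t + 1) ω‖ ^ 2 / (2 * η (t + 1))) with hS
  have hpath : ∀ᵐ ω ∂Pr, A * (f (x (n + 1) ω) + φ (x (n + 1) ω)) ≤ A * (f xs + φ xs) + S ω := by
    filter_upwards [H.x_mem, H.y_mem, H.z_mem, ae_all_iff.2 fun t => (H.minimizer t)]
      with ω hx hy hz hmin
    exact hrun.sample_path_bound hd hm hL₀ hR hu hφconvex hψ huₜ hη hL HB hball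
      (fun t ω h => oracleMean_perturbedOracle (hO t) h) hxs hψxs hx hz hy
      (fun t => (hmin t).2) n
  -- The expectation of the right-hand side.
  have hterm : ∀ t, Integrable (fun ω => 1 / theta t * (⟪G t ω - avg t ω, z t ω - xs⟫
      + ‖G t ω - avg t ω‖ ^ 2 / (2 * η t))) Pr := fun t =>
    ((hnoise t).2.2.1.add ((integrable_norm_sq (hnoise t).1).div_const _)).const_mul _
  have hSsum := integrable_finsetSum (Finset.range n) fun t _ => hterm (t + 1)
  have hS1 : Integrable (fun ω => K + 2 * (R / L₀) * ‖avg 0 ω‖ ^ 2) Pr :=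
    (integrable_const K).add (havg0.1.const_mul _)
  have hSi : Integrable S Pr := hS1.add hSsum
  have hSle : ∫ ω, S ω ∂Pr ≤ A * (10 * L₀ * R * (d : ℝ) ^ (1 / 4 : ℝ) / ((n + 1 : ℕ) : ℝ)
      + 5 * L₀ * R / √(((n + 1 : ℕ) : ℝ) * m)) := by
    refine le_trans ?_ (rate_bound hd hm hL₀ hR hu huₜ hη hL hn)
    rw [hS, integral_add hS1 hSsum, integral_add (integrable_const K) (havg0.1.const_mul _),
      integral_const_mul, integral_finsetSum _ fun t _ => hterm (t + 1)]
    have h1 : 2 * (R / L₀) * ∫ ω, ‖avg 0 ω‖ ^ 2 ∂Pr ≤ 2 * L₀ * R :=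
      calc _ ≤ 2 * (R / L₀) * L₀ ^ 2 := by gcongr; exact havg0.2
        _ = _ := by field_simp
    have h2 : ∀ t, ∫ ω, 1 / theta t * (⟪G t ω - avg t ω, z t ω - xs⟫
        + ‖G t ω - avg t ω‖ ^ 2 / (2 * η t)) ∂Pr ≤ 1 / theta t * (L₀ ^ 2 / m / (2 * η t)) := by
      intro t
      rw [integral_const_mul, integral_add (hnoise t).2.2.1
        ((integrable_norm_sq (hnoise t).1).div_const _), (hnoise t).2.2.2, zero_add,
        integral_div]
      have h3 := (one_div_theta_pos t).le
      have h4 := hηp t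
      have h5 := (hnoise t).2.1
      gcongr
    have h3 := Finset.sum_le_sum fun t (_ : t ∈ Finset.range n) => h2 (t + 1)
    simp only [integral_const, probReal_univ, one_smul]
    linarith
  -- Measurability and the integrable lower bound.
  obtain ⟨f', hf'm, hf'⟩ := exists_measurable_eqOn hXclosed
    (HB.continuousOn.mono hXU).lowerSemicontinuousOn ⟨xs, hxs⟩
  obtain ⟨φ', hφ'm, hφ'⟩ := exists_measurable_eqOn hXclosed hφclosed ⟨xs, hxs⟩
  obtain ⟨C, hC0, hC⟩ := exists_linear_lower_bound hXclosed hφconvex hφclosed hxs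
  have hx2 := (H.adapted (n + 1)).1.2
  have hxi : Integrable (fun ω => ‖x (n + 1) ω - xs‖) Pr :=
    ((hx2.integrable one_le_two).sub (integrable_const xs)).norm
  have hmeas : AEStronglyMeasurable (fun ω => f (x (n + 1) ω) + φ (x (n + 1) ω)) Pr := by
    have h1 : AEMeasurable (fun ω => f' (x (n + 1) ω) + φ' (x (n + 1) ω)) Pr :=
      (hf'm.comp_aemeasurable hx2.1.aemeasurable).add (hφ'm.comp_aemeasurable hx2.1.aemeasurable)
    refine h1.aestronglyMeasurable.congr ?_
    filter_upwards [H.x_mem] with ω hx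
    rw [hf' _ (hx _), hφ' _ (hx _)]
  have hupper : Integrable (fun ω => (f xs + φ xs) + A⁻¹ * S ω) Pr :=
    (integrable_const _).add (hSi.const_mul _)
  have hlower : Integrable (fun ω => f xs - L₀ * ‖x (n + 1) ω - xs‖
      - C * (1 + ‖x (n + 1) ω - xs‖)) Pr :=
    ((integrable_const _).sub (hxi.const_mul _)).sub (((integrable_const 1).add hxi).const_mul _)
  have hle : ∀ᵐ ω ∂Pr, f (x (n + 1) ω) + φ (x (n + 1) ω) ≤ (f xs + φ xs) + A⁻¹ * S ω := by
    filter_upwards [hpath] with ω h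
    refine le_of_mul_le_mul_left ?_ hApos
    rwa [mul_add A (f xs + φ xs), mul_inv_cancel_left₀ hApos.ne']
  have hint : Integrable (fun ω => f (x (n + 1) ω) + φ (x (n + 1) ω)) Pr := by
    refine integrable_of_le_of_le hmeas ?_ hle hlower hupper
    filter_upwards [H.x_mem] with ω hx
    have h1 := HB.sub_le (hXU hxs) (hXU (hx (n + 1)))
    rw [norm_sub_rev] at h1
    linarith [hC _ (hx (n + 1))]
  refine ⟨hint, ?_⟩
  have h1 := integral_mono_ae hint hupper hle
  rw [integral_add (integrable_const _) (hSi.const_mul _), integral_const_mul] at h1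
  simp only [integral_const, probReal_univ, one_smul] at h1
  have h2 := mul_le_mul_of_nonneg_left hSle (inv_nonneg.2 hApos.le)
  rw [inv_mul_cancel_left₀ hApos.ne'] at h2
  linarith
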